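/- Let $N\in\mathbb N$, let $\Omega=\{\omega=(\omega_0,\dots,\omega_N)\in\mathbb R_+^{N+1}:\omega_0=1\}$ with the topology and Borel $\sigma$-algebra inherited from $\mathbb R^{N+1}$, let $\mathbb S_k(\omega)=\omega_k$ be the canonical process, $\mathcal F_k=\sigma(\mathbb S_0,\dots,\mathbb S_k)$ and $\|\omega\|=\max_{0\le k\le N}\omega_k$. Fix $0<\kappa<1/4$ and $p>2$, and let $\mathcal H$ be the vector space of Borel functions $f:\mathbb R_+\to\mathbb R$ for which there is $C>0$ with $|f(x)|\le C(1+x^p)$ for all $x\ge 0$. Let $\mathcal P:\mathcal H\to\mathbb R$ be convex with $\mathcal P(a)=a$ for every constant $a\in\mathbb R$ and $\mathcal P(\lambda f)=\lambda\mathcal P(f)$ for all $\lambda>0$, $f\in\mathcal H$, and suppose that $\limsup_{n\to\infty}\mathcal P(f_n)\le\mathcal P(f)$ whenever $f_n,f\in\mathcal H$, $f_n\to f$ pointwise, and there is a constant $C$ with $|f_n(x)|\le C(1+x^p)$ for all $n$ and all $x\ge 0$. A portfolio is a pair $(f,\gamma)$ with $f\in\mathcal H$ and $\gamma:\{0,\dots,N-1\}\times\Omega\to\mathbb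 R$ such that $\gamma(i,\omega)=\gamma(i,\tilde\omega)$ whenever $\omega_j=\tilde\omega_j$ for all $j\le i$. With $\gamma(-1,\cdot)\equiv 0$, its value at maturity is $$Y_N^{(f,\gamma)}=f(\mathbb S_N)+\sum_{i=0}^{N-1}\gamma(i,\mathbb S)(\mathbb S_{i+1}-\mathbb S_i)-\kappa\sum_{i=0}^{N-1}\mathbb S_i\,|\gamma(i,\mathbb S)-\gamma(i-1,\mathbb S)| .$$ For $G:\Omega\to\mathbb R$ let $V(G)\in[-\infty,\infty]$ be the infimum of $\mathcal P(f)$ over all portfolios $(f,\gamma)$ with $Y_N^{(f,\gamma)}(\omega)\ge G(\omega)$ for every $\omega\in\Omega$. Call $G$ admissible if it is upper semicontinuous and there is $L>0$ with $|G(\omega)|\le L(1+\|\omega\|^2)$ for all $\omega\in\Omega$. Let $\mathcal M_{\kappa,\mathcal P}$ be the set of Borel probability measures $\mathbb Q$ on $\Omega$ such that $\mathbb S_N$ is $\mathbb Q$-integrable, for every $0\le k<N$ $$(1-\kappa)\mathbb S_k\le\mathbb E_{\mathbb Q}[\mathbb S_N\mid\mathcal F_k]\le(1+\kappa)\mathbb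 S_k\quad\mathbb Q\text{-a.s.},$$ and, for every $f\in\mathcal H$, $f(\mathbb S_N)$ is $\mathbb Q$-integrable with $\mathbb E_{\mathbb Q}[f(\mathbb S_N)]\le\mathcal P(f)$. Say that there is no model-independent arbitrage if $V(G)\ge 0$ for every admissible $G\ge 0$, and that there is no local arbitrage if $V(G)>0$ for every continuous bounded $G\ge 0$ with $G\not\equiv 0$. Then: 1. There is no model-independent arbitrage if and only if $\mathcal M_{\kappa,\mathcal P}\ne\emptyset$. Moreover, there is no model-independent arbitrage if and only if $V(G)>-\infty$ for some admissible $G$. 2. There is no local arbitrage if and only if for every nonempty open set $O\subset\Omega$ there is $\mathbb Q\in\mathcal M_{\kappa,\mathcal P}$ with $\mathbb Q(O)>0$. -/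

import Mathlib

open MeasureTheory Filter Topology
open scoped NNReal

namespace RobustHedging

/-- The set `Ω` of all price paths `(ω_0, …, ω_N)` with `ω_0 = 1` and `ω_k ≥ 0`. It carries the
topology and the Borel sigma-algebra of a subspace of `ℝ₊^(N+1)`. -/
abbrev PathSpace (N : ℕ) : Type := {ω : Fin (N + 1) → ℝ≥0 // ω 0 = 1}

/-- The canonical process `S_k(ω) = ω_k`, as a real number. -/
def price {N : ℕ} (k : Fin (N + 1)) (ω : PathSpace N) : ℝ := (ω.1 k : ℝ)

/-- The terminal price `S_N(ω)`, as an element of `ℝ₊`. -/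
def terminal {N : ℕ} (ω : PathSpace N) : ℝ≥0 := ω.1 (Fin.last N)

/-- `‖ω‖ = max_{0 ≤ k ≤ N} |ω_k|`. -/
def pathNorm {N : ℕ} (ω : PathSpace N) : ℝ := (Finset.univ.sup ω.1 : ℝ≥0)

/-- The standing assumption on claims: upper semicontinuity and quadratic growth. -/
def Admissible {N : ℕ} (G : PathSpace N → ℝ) : Prop :=
  UpperSemicontinuous G ∧ ∃ L : ℝ, 0 < L ∧ ∀ ω, |G ω| ≤ L * (1 + pathNorm ω ^ 2)

/-- The vector space `H` of Borel functions `f : ℝ₊ → ℝ` with `|f(x)| ≤ C (1 + x^p)`. -/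
def optionSpace (p : ℝ) : Submodule ℝ (ℝ≥0 → ℝ) where
  carrier := {f | Measurable f ∧ ∃ C : ℝ, 0 < C ∧ ∀ x : ℝ≥0, |f x| ≤ C * (1 + (x : ℝ) ^ p)}
  zero_mem' := by
    refine ⟨measurable_const, 1, one_pos, fun x => ?_⟩
    have : (0 : ℝ) ≤ (x : ℝ) ^ p := Real.rpow_nonneg x.2 p
    simp only [Pi.zero_apply, abs_zero]
    linarith
  add_mem' := by
    rintro f g ⟨hf, C, hC, hfC⟩ ⟨hg, D, hD, hgD⟩
    refine ⟨hf.add hg, C + D, add_pos hC hD, fun x => ?_⟩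
    have h1 := hfC x
    have h2 := hgD x
    have h3 := abs_add_le (f x) (g x)
    simp only [Pi.add_apply]
    linarith
  smul_mem' := by
    rintro c f ⟨hf, C, hC, hfC⟩
    refine ⟨hf.const_smul c, (|c| + 1) * C, by positivity, fun x => ?_⟩
    have hx : (0 : ℝ) ≤ (x : ℝ) ^ p := Real.rpow_nonneg x.2 p
    have h1 : |c| * |f x| ≤ |c| * (C * (1 + (x : ℝ) ^ p)) :=
      mul_le_mul_of_nonneg_left (hfC x) (abs_nonneg c)
    have h2 : 0 ≤ C * (1 + (x : ℝ) ^ p) := by positivity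
    simp only [Pi.smul_apply, smul_eq_mul, abs_mul]
    linarith

/-- The constant payoff `a` as an element of `H`. -/
def constOption (p a : ℝ) : optionSpace p :=
  ⟨fun _ => a, measurable_const, |a| + 1, by positivity, fun x => by
    have hx : (0 : ℝ) ≤ (x : ℝ) ^ p := Real.rpow_nonneg x.2 p
    have h : 0 ≤ (|a| + 1) * (x : ℝ) ^ p := by positivity
    linarith⟩

/-- The assumptions on the pricing operator `P : H → ℝ`: it is convex, exact on constants,
positively homogeneous, and `P(f) ≥ limsup P(f_n)` whenever `f_n → f` pointwise in `H` under a
common growth bound `|f_n(x)| ≤ C (1 + x^p)`. -/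
structure IsPricing (p : ℝ) (P : optionSpace p → ℝ) : Prop where
  convex : ConvexOn ℝ Set.univ P
  const : ∀ a : ℝ, P (constOption p a) = a
  homogeneous : ∀ (c : ℝ) (f : optionSpace p), 0 < c → P (c • f) = c * P f
  limsup_le : ∀ (F : ℕ → optionSpace p) (f : optionSpace p),
    (∃ C : ℝ, ∀ (n : ℕ) (x : ℝ≥0), |(F n).1 x| ≤ C * (1 + (x : ℝ) ^ p)) →
    (∀ x : ℝ≥0, Tendsto (fun n => (F n).1 x) atTop (𝓝 (f.1 x))) →
    limsup (fun n => ((P (F n) : ℝ) : EReal)) atTop ≤ ((P f : ℝ) : EReal)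

/-- A trading strategy `γ(i, ω)`, `0 ≤ i ≤ N - 1`, whose value at time `i` depends only on
`ω_0, …, ω_i`. -/
def IsProgressive {N : ℕ} (γ : Fin N → PathSpace N → ℝ) : Prop :=
  ∀ (i : Fin N) (ω ω' : PathSpace N),
    (∀ j : Fin (N + 1), j ≤ i.castSucc → ω.1 j = ω'.1 j) → γ i ω = γ i ω'

/-- The position `γ(i - 1, ω)` held before the trade at time `i`, with `γ(-1, ·) = 0`. -/
def prevPosition {N : ℕ} (γ : Fin N → PathSpace N → ℝ) (i : Fin N) (ω : PathSpace N) : ℝ :=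
  if i.1 = 0 then 0 else γ ⟨i.1 - 1, lt_of_le_of_lt (Nat.sub_le _ _) i.2⟩ ω

/-- The portfolio value at maturity under proportional transaction costs of rate `κ`. -/
def portfolioValue {N : ℕ} (κ : ℝ) (f : ℝ≥0 → ℝ) (γ : Fin N → PathSpace N → ℝ)
    (ω : PathSpace N) : ℝ :=
  f (terminal ω) + ∑ i : Fin N, γ i ω * (price i.succ ω - price i.castSucc ω)
    - κ * ∑ i : Fin N, price i.castSucc ω * |γ i ω - prevPosition γ i ω|

/-- The minimal super-replication cost `V(G)`: the infimum, in the extended reals, of `P(f)` over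
all portfolios `(f, γ)` with `f ∈ H` that dominate `G` on every path. -/
noncomputable def superCost {N : ℕ} (κ : ℝ) {p : ℝ} (P : optionSpace p → ℝ)
    (G : PathSpace N → ℝ) : EReal :=
  sInf {c : EReal | ∃ (f : optionSpace p) (γ : Fin N → PathSpace N → ℝ),
    IsProgressive γ ∧ (∀ ω, G ω ≤ portfolioValue κ f.1 γ ω) ∧ c = ((P f : ℝ) : EReal)}

lemma continuous_price {N : ℕ} (k : Fin (N + 1)) : Continuous (price (N := N) k) :=
  NNReal.continuous_coe.comp ((continuous_apply k).comp continuous_subtype_val)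

/-- The canonical filtration `F_k = σ(S_0, …, S_k)`. -/
noncomputable def canonicalFiltration (N : ℕ) :
    Filtration (Fin (N + 1)) (inferInstance : MeasurableSpace (PathSpace N)) :=
  Filtration.natural (fun k => price k) (fun k => (continuous_price k).stronglyMeasurable)

/-- `Q` is a `κ`-approximate martingale law: `S_N` is integrable and the conditional expectations
of `S_N` form a consistent price system. (`S_0 = 1` holds on all of `Ω`.) -/
def IsApproxMartingaleLaw {N : ℕ} (κ : ℝ) (Q : Measure (PathSpace N)) : Prop :=
  IsProbabilityMeasure Q ∧ Integrable (price (Fin.last N)) Q ∧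
  ∀ k : Fin (N + 1), k < Fin.last N →
    ∀ᵐ ω ∂Q, (1 - κ) * price k ω ≤ (Q[price (Fin.last N) | canonicalFiltration N k]) ω ∧
      (Q[price (Fin.last N) | canonicalFiltration N k]) ω ≤ (1 + κ) * price k ω

/-- The set `M_{κ,P}` of `κ`-approximate martingale laws `Q` with `E_Q[f(S_N)] ≤ P(f)` for every
`f ∈ H` (the expectation being well defined). -/
def consistentLaws (N : ℕ) (κ : ℝ) {p : ℝ} (P : optionSpace p → ℝ) :
    Set (Measure (PathSpace N)) :=
  {Q | IsApproxMartingaleLaw κ Q ∧ ∀ f : optionSpace p,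
    Integrable (fun ω => f.1 (terminal ω)) Q ∧ ∫ ω, f.1 (terminal ω) ∂Q ≤ P f}

/-- No model-independent arbitrage. -/
def NoModelIndependentArbitrage (N : ℕ) (κ : ℝ) {p : ℝ} (P : optionSpace p → ℝ) : Prop :=
  ∀ G : PathSpace N → ℝ, Admissible G → (∀ ω, 0 ≤ G ω) → 0 ≤ superCost κ P G

/-- No local arbitrage. -/
def NoLocalArbitrage (N : ℕ) (κ : ℝ) {p : ℝ} (P : optionSpace p → ℝ) : Prop :=
  ∀ G : PathSpace N → ℝ, Continuous G → (∃ C : ℝ, ∀ ω, |G ω| ≤ C) → (∀ ω, 0 ≤ G ω) →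
    (∃ ω, G ω ≠ 0) → 0 < superCost κ P G

end RobustHedging

/-! Everything rests on one duality: in the absence of arbitrage, every bounded continuous claim `G`
has a law `Q` in `consistentLaws` under which its expectation equals its super-replication cost
(`exists_integral_eq_sInf_hedgePrices`).

Weak duality (`integral_le_of_mem_hedgePrices`) bounds expectations under consistent laws by hedging
costs. Parametrised by trades held to maturity, a strategy has a gain that is superadditive and
positively homogeneous. Strategies need be neither measurable nor integrable, so trades are removed
one at a time from the last, conditioning with a regular conditional law on which each past trade is
constant.

For strong duality, absence of arbitrage makes the cost a finite sublinear functional on the claims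
hedgeable from both sides. Hahn–Banach gives a linear `ℓ` below the cost and equal to it at `G`, and
Riesz–Markov represents `ℓ` on compactly supported continuous claims by a measure `Q`. No mass
escapes to infinity because a quadratic function of the whole path has finite cost: hence `Q`
represents `ℓ` on continuous claims of linear growth. Free trades with bounded continuous weights
then force the conditional bounds on the terminal price. The limsup condition on `P` makes `ℓ`
continuous along dominated sequences of static positions, so a monotone class argument extends the
representation to all of `optionSpace p`.

Both equivalences follow. A negative cost for the zero claim can be scaled up, driving the cost of
every hedgeable claim to minus infinity; the duality at the zero claim supplies a consistent law.
For local arbitrage, strong duality is applied to a bump function inside the open set, and weak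
duality to a law charging the set where the claim is positive. -/

namespace RobustHedging

/-! ### Integrability of limits and conditional expectations -/

section MeasureTheory

open scoped BoundedContinuousFunction ENNReal

/-- Fatou: a pointwise limit of functions bounded in `L¹` is integrable. -/
lemma integrable_of_tendsto_of_integral_abs_le {α : Type*} [MeasurableSpace α] {μ : Measure α}
    {g : ℕ → α → ℝ} {f : α → ℝ} {C : ℝ} (hg : ∀ n, Integrable (g n) μ)
    (hle : ∀ n, ∫ x, |g n x| ∂μ ≤ C) (h : ∀ x, Tendsto (fun n => g n x) atTop (𝓝 (f x))) :
    Integrable f μ := by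
  refine ⟨aestronglyMeasurable_of_tendsto_ae atTop (fun n => (hg n).1) (ae_of_all _ h), ?_⟩
  have h1 : ∫⁻ x, ‖f x‖ₑ ∂μ ≤ liminf (fun n => ∫⁻ x, ‖g n x‖ₑ ∂μ) atTop := by
    rw [lintegral_congr fun x => ((h x).enorm.liminf_eq).symm]
    exact lintegral_liminf_le' fun n => (hg n).1.enorm
  refine (h1.trans (liminf_le_of_le (by isBoundedDefault) (a := ENNReal.ofReal C) ?_)).trans_lt
    ENNReal.ofReal_lt_top
  intro b hb
  obtain ⟨n, hn⟩ := hb.exists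
  refine hn.trans ?_
  rw [← ofReal_integral_norm_eq_lintegral_enorm (hg n)]
  exact ENNReal.ofReal_le_ofReal (hle n)

/-- If `Z` integrates to a nonnegative number against every nonnegative bounded continuous
function of `π`, then its conditional expectation given `π` is nonnegative. -/
lemma condExp_nonneg_of_forall_continuous {Ω T : Type*} [mΩ : MeasurableSpace Ω] {Q : Measure Ω}
    [IsFiniteMeasure Q] [TopologicalSpace T] [TopologicalSpace.PseudoMetrizableSpace T]
    [mT : MeasurableSpace T] [BorelSpace T] {π : Ω → T} (hπ : Measurable π) {Z : Ω → ℝ}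
    (hZ : Integrable Z Q) (h : ∀ φ : T →ᵇ ℝ≥0, 0 ≤ ∫ ω, (φ (π ω) : ℝ) * Z ω ∂Q) :
    0 ≤ᵐ[Q] Q[Z | mT.comap π] := by
  have hle : mT.comap π ≤ mΩ := hπ.comap_le
  have hclosed : ∀ F : Set T, IsClosed F → 0 ≤ ∫ ω in π ⁻¹' F, Z ω ∂Q := by
    intro F hF
    rw [← integral_indicator (hπ hF.measurableSet)]
    -- The indicator of a closed set is a pointwise limit of continuous functions with values in [0,
    -- 1].
    refine ge_of_tendsto' (f := fun n => ∫ ω, (hF.apprSeq n (π ω) : ℝ) * Z ω ∂Q) (x := atTop) ?_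
      fun n => h _
    refine tendsto_integral_of_dominated_convergence (fun ω => ‖Z ω‖) (fun n => ?_) hZ.norm
      (fun n => ae_of_all _ fun ω => ?_) (ae_of_all _ fun ω => ?_)
    · exact ((measurable_coe_nnreal_real.comp ((hF.apprSeq n).continuous.measurable.comp
        hπ)).aestronglyMeasurable).mul hZ.1
    · rw [norm_mul]
      refine mul_le_of_le_one_left (norm_nonneg _) ?_
      have := HasOuterApproxClosed.apprSeq_apply_le_one hF n (π ω)
      rw [Real.norm_of_nonneg (NNReal.coe_nonneg _)]
      exact_mod_cast this
    · have h1 := tendsto_pi_nhds.1 (HasOuterApproxClosed.tendsto_apprSeq hF) (π ω)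
      have h2 := ((NNReal.continuous_coe.tendsto _).comp h1).mul_const (Z ω)
      have h3 : (π ⁻¹' F).indicator Z ω
          = ((F.indicator (fun _ => (1 : ℝ≥0)) (π ω) : ℝ≥0) : ℝ) * Z ω := by
        by_cases hω : π ω ∈ F
        · rw [Set.indicator_of_mem hω, Set.indicator_of_mem (show ω ∈ π ⁻¹' F from hω)]; simp
        · rw [Set.indicator_of_notMem hω, Set.indicator_of_notMem (show ω ∉ π ⁻¹' F from hω)]
          simp
      rw [h3]
      exact h2
  have hmeas : ∀ B : Set T, MeasurableSet B → 0 ≤ ∫ ω in π ⁻¹' B, Z ω ∂Q := by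
    intro B hB
    have hfin : IsFiniteMeasure (Q.withDensity fun ω => ‖Z ω‖ₑ) :=
      isFiniteMeasure_withDensity hZ.2.ne
    -- Inner regularity is applied to the image of |Z| Q, so that the integral of Z over the
    -- discarded part of B is small.
    let ρ := (Q.withDensity fun ω => ‖Z ω‖ₑ).map π
    have : IsFiniteMeasure ρ := inferInstance
    refine le_of_forall_pos_le_add fun ε hε => ?_
    obtain ⟨F, hFB, hF, hlt⟩ := hB.exists_isClosed_sdiff_lt (μ := ρ) (measure_ne_top _ _)
      (ENNReal.ofReal_pos.2 hε).ne'
    have hBF : MeasurableSet (π ⁻¹' (B \ F)) := hπ (hB.diff hF.measurableSet)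
    have hsplit : ∫ ω in π ⁻¹' B, Z ω ∂Q
        = (∫ ω in π ⁻¹' (B \ F), Z ω ∂Q) + ∫ ω in π ⁻¹' F, Z ω ∂Q := by
      rw [← setIntegral_union (Set.disjoint_sdiff_left.preimage π) (hπ hF.measurableSet)
        hZ.integrableOn hZ.integrableOn, ← Set.preimage_union, Set.sdiff_union_of_subset hFB]
    have hsmall : ‖∫ ω in π ⁻¹' (B \ F), Z ω ∂Q‖ ≤ ε := by
      refine (norm_integral_le_integral_norm _).trans ?_
      rw [integral_norm_eq_lintegral_enorm hZ.1.restrict]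
      refine ENNReal.toReal_le_of_le_ofReal hε.le ?_
      rw [← withDensity_apply _ hBF, ← Measure.map_apply hπ (hB.diff hF.measurableSet)]
      exact hlt.le
    have := hclosed F hF
    rw [Real.norm_eq_abs] at hsmall
    linarith [neg_le_of_abs_le hsmall]
  refine ae_of_ae_trim hle (ae_nonneg_of_forall_setIntegral_nonneg
    (integrable_condExp.trim hle stronglyMeasurable_condExp) ?_)
  rintro s ⟨B, hB, rfl⟩ -
  rw [← setIntegral_trim hle stronglyMeasurable_condExp ⟨B, hB, rfl⟩,
    setIntegral_condExp hle hZ ⟨B, hB, rfl⟩]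
  exact hmeas B hB

/-- An affine bound of `X` by `M` whose coefficients depend only on `π` (in a possibly
nonmeasurable way) passes to conditional expectations given `π`. -/
lemma condExp_le_mul_condExp_add {Ω T : Type*} [mΩ : MeasurableSpace Ω] [StandardBorelSpace Ω]
    {Q : Measure Ω} [IsFiniteMeasure Q] [mT : MeasurableSpace T] [MeasurableEq T]
    {π : Ω → T} (hπ : Measurable π) {X M A B : Ω → ℝ} (hX : Integrable X Q) (hM : Integrable M Q)
    (hA : ∀ ω ω', π ω = π ω' → A ω = A ω') (hB : ∀ ω ω', π ω = π ω' → B ω = B ω')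
    (h : ∀ᵐ ω ∂Q, X ω ≤ A ω * M ω + B ω) :
    ∀ᵐ ω ∂Q, (Q[X | mT.comap π]) ω ≤ A ω * (Q[M | mT.comap π]) ω + B ω := by
  have hle : mT.comap π ≤ mΩ := hπ.comap_le
  have hfiber : ∀ᵐ ω ∂Q, ∀ᵐ ω' ∂ProbabilityTheory.condExpKernel Q (mT.comap π) ω,
      π ω = π ω' := by
    -- Coupling `Q` with its conditional kernel gives the law of (ω, ω). Hence almost every
    -- conditional law lives on a single fibre of π, where A and B are constants.
    refine ae_of_ae_trim hle (Measure.ae_ae_of_ae_compProd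
      (p := fun q : Ω × Ω => π q.1 = π q.2) ?_)
    rw [ProbabilityTheory.compProd_trim_condExpKernel]
    have hset : @MeasurableSet _ ((mT.comap π).prod mΩ) {q : Ω × Ω | π q.1 = π q.2} := by
      refine @measurableSet_eq_fun _ _ ((mT.comap π).prod mΩ) _ _ _ _ ?_ ?_
      · exact (comap_measurable π).comp (@measurable_fst _ _ (mT.comap π) mΩ)
      · exact hπ.comp (@measurable_snd _ _ (mT.comap π) mΩ)
    have hdiag : @Measurable _ _ mΩ ((mT.comap π).prod mΩ) (Function.diag : Ω → Ω × Ω) :=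
      @Measurable.prodMk Ω mΩ Ω Ω (mT.comap π) mΩ _ _ (measurable_id'' hle) measurable_id
    rw [@ae_map_iff _ _ mΩ ((mT.comap π).prod mΩ) _ _
      (@Measurable.aemeasurable _ _ mΩ ((mT.comap π).prod mΩ) _ _ hdiag) _ hset]
    exact ae_of_all _ fun ω => rfl
  have hker : ∀ᵐ ω ∂Q, ∀ᵐ ω' ∂ProbabilityTheory.condExpKernel Q (mT.comap π) ω,
      X ω' ≤ A ω' * M ω' + B ω' := by
    refine ae_of_ae_trim hle (Measure.ae_ae_of_ae_comp ?_)
    rwa [ProbabilityTheory.condExpKernel_comp_trim hle]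
  filter_upwards [hfiber, hker, hX.condExpKernel_ae (m := mT.comap π),
    hM.condExpKernel_ae (m := mT.comap π),
    ProbabilityTheory.condExp_ae_eq_integral_condExpKernel hle hX,
    ProbabilityTheory.condExp_ae_eq_integral_condExpKernel hle hM] with ω h1 h2 h3 h4 h5 h6
  rw [h5, h6, ← integral_const_mul]
  have hc : B ω = ∫ _, B ω ∂ProbabilityTheory.condExpKernel Q (mT.comap π) ω := by simp
  rw [hc, ← integral_add (h4.const_mul _) (integrable_const _)]
  refine integral_mono_ae h3 ((h4.const_mul _).add (integrable_const _)) ?_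
  filter_upwards [h1, h2] with ω' h7 h8
  rw [hA ω ω' h7, hB ω ω' h7]
  exact h8

end MeasureTheory

/-! ### Sublinearity of the pricing operator -/

section Pricing

variable {p : ℝ} {P : optionSpace p → ℝ}

lemma IsPricing.map_zero (hP : IsPricing p P) : P 0 = 0 := by
  rw [← hP.const 0]; rfl

lemma IsPricing.map_add_le (hP : IsPricing p P) (f g : optionSpace p) :
    P (f + g) ≤ P f + P g := by
  have h1 := hP.convex.2 (Set.mem_univ f) (Set.mem_univ g) (show (0 : ℝ) ≤ 1 / 2 by norm_num)
    (show (0 : ℝ) ≤ 1 / 2 by norm_num) (by norm_num)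
  have h2 := hP.homogeneous (1 / 2) (f + g) (by norm_num)
  rw [smul_add] at h2
  rw [h2] at h1
  simp only [smul_eq_mul] at h1
  linarith

end Pricing

/-! ### Trades held to maturity and the calculus of hedging costs -/

section Hedging

variable {N : ℕ} {κ p : ℝ} {P : optionSpace p → ℝ}

lemma price_nonneg (k : Fin (N + 1)) (ω : PathSpace N) : 0 ≤ price k ω := (ω.1 k).2

/-- The gain from buying `δ i` shares at each time `i` and holding them to maturity, net of
transaction costs. -/
def gain (κ : ℝ) (δ : Fin N → PathSpace N → ℝ) (ω : PathSpace N) : ℝ :=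
  ∑ i : Fin N, (δ i ω * (price (Fin.last N) ω - price i.castSucc ω)
    - κ * (price i.castSucc ω * |δ i ω|))

/-- The number of shares traded at time `i` under the strategy `γ`. -/
def trades (γ : Fin N → PathSpace N → ℝ) (i : Fin N) (ω : PathSpace N) : ℝ :=
  γ i ω - prevPosition γ i ω

/-- The positions resulting from the trades `δ`. -/
def positions (δ : Fin N → PathSpace N → ℝ) (i : Fin N) (ω : PathSpace N) : ℝ :=
  ∑ j ∈ Finset.Iic i, δ j ω

/-- Summation by parts: each change of position earns the price increments from its own date to the
end. -/
lemma sum_range_mul_sub_eq_sum_sub_mul (g s : ℕ → ℝ) (hg : g 0 = 0) (n : ℕ) :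
    ∑ i ∈ Finset.range n, g (i + 1) * (s (i + 1) - s i)
      = ∑ i ∈ Finset.range n, (g (i + 1) - g i) * (s n - s i) := by
  induction n with
  | zero => simp
  | succ n ih =>
    have h1 : ∑ i ∈ Finset.range n, (g (i + 1) - g i) * (s (n + 1) - s i)
        = ∑ i ∈ Finset.range n, (g (i + 1) - g i) * (s n - s i)
          + (∑ i ∈ Finset.range n, (g (i + 1) - g i)) * (s (n + 1) - s n) := by
      rw [Finset.sum_mul, ← Finset.sum_add_distrib]
      exact Finset.sum_congr rfl fun i _ => by ring
    rw [Finset.sum_range_succ, Finset.sum_range_succ, ih, h1, Finset.sum_range_sub, hg]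
    ring

lemma portfolioValue_eq (κ : ℝ) (f : ℝ≥0 → ℝ) (γ : Fin N → PathSpace N → ℝ) (ω : PathSpace N) :
    portfolioValue κ f γ ω = f (terminal ω) + gain κ (trades γ) ω := by
  let s : ℕ → ℝ := fun j => if h : j < N + 1 then price ⟨j, h⟩ ω else 0
  -- The index is shifted by one: g j is the position before the trade at time j, and g 0 = 0
  -- encodes γ(-1, ·) = 0.
  let g : ℕ → ℝ := fun j => if j = 0 then 0 else if h : j - 1 < N then γ ⟨j - 1, h⟩ ω else 0
  have hs : ∀ i : Fin N, s (i : ℕ) = price i.castSucc ω := fun i => by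
    simp only [s, dif_pos (show (i : ℕ) < N + 1 by omega)]; rfl
  have hs' : ∀ i : Fin N, s ((i : ℕ) + 1) = price i.succ ω := fun i => by
    simp only [s, dif_pos (show (i : ℕ) + 1 < N + 1 by omega)]; rfl
  have hsN : s N = price (Fin.last N) ω := by
    simp only [s, dif_pos (Nat.lt_succ_self N)]; rfl
  have hg' : ∀ i : Fin N, g ((i : ℕ) + 1) = γ i ω := fun i => by
    simp [g]
  have hg : ∀ i : Fin N, g (i : ℕ) = prevPosition γ i ω := fun i => by
    simp only [g, prevPosition]
    split_ifs with h1 h2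
    · rfl
    · rfl
    · omega
  have key := sum_range_mul_sub_eq_sum_sub_mul g s (by simp [g]) N
  rw [← Fin.sum_univ_eq_sum_range (fun i => g (i + 1) * (s (i + 1) - s i)),
    ← Fin.sum_univ_eq_sum_range (fun i => (g (i + 1) - g i) * (s N - s i))] at key
  simp only [hs, hs', hg, hg', hsN] at key
  simp only [portfolioValue, gain, trades, key, Finset.sum_sub_distrib, Finset.mul_sum]
  ring

lemma trades_positions (δ : Fin N → PathSpace N → ℝ) : trades (positions δ) = δ := by
  funext i ω
  obtain ⟨i, hi⟩ := i
  cases i with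
  | zero =>
    have : Finset.Iic (⟨0, hi⟩ : Fin N) = {⟨0, hi⟩} := by
      ext j; simp [Fin.le_def, Fin.ext_iff]
    simp [trades, positions, prevPosition, this]
  | succ n =>
    have : Finset.Iic (⟨n + 1, hi⟩ : Fin N)
        = insert ⟨n + 1, hi⟩ (Finset.Iic ⟨n, (Nat.lt_succ_self n).trans hi⟩) := by
      ext j; simp only [Finset.mem_Iic, Finset.mem_insert, Fin.le_def, Fin.ext_iff]; omega
    have hn : (⟨n + 1, hi⟩ : Fin N) ∉ Finset.Iic (⟨n, (Nat.lt_succ_self n).trans hi⟩ : Fin N) := by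
      simp [Fin.le_def]
    simp [trades, positions, prevPosition, this, Finset.sum_insert hn]

lemma IsProgressive.trades {γ : Fin N → PathSpace N → ℝ} (hγ : IsProgressive γ) :
    IsProgressive (trades γ) := by
  intro i ω ω' h
  have h2 : prevPosition γ i ω = prevPosition γ i ω' := by
    unfold prevPosition
    split_ifs with h0
    · rfl
    · refine hγ _ ω ω' fun j hj => h j (hj.trans ?_)
      simp [Fin.le_def]
  simp only [RobustHedging.trades, hγ i ω ω' h, h2]

lemma IsProgressive.positions {δ : Fin N → PathSpace N → ℝ} (hδ : IsProgressive δ) :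
    IsProgressive (positions δ) := by
  intro i ω ω' h
  refine Finset.sum_congr rfl fun j hj => hδ j ω ω' fun l hl => h l (hl.trans ?_)
  simpa using hj

/-- The prices of the static positions that, with some trades, dominate `G`. -/
def hedgePrices (κ : ℝ) (P : optionSpace p → ℝ) (G : PathSpace N → ℝ) : Set ℝ :=
  {c | ∃ (f : optionSpace p) (δ : Fin N → PathSpace N → ℝ),
    IsProgressive δ ∧ (∀ ω, G ω ≤ f.1 (terminal ω) + gain κ δ ω) ∧ c = P f}

lemma superCost_eq (κ : ℝ) (P : optionSpace p → ℝ) (G : PathSpace N → ℝ) :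
    superCost κ P G = sInf ((fun c : ℝ => (c : EReal)) '' hedgePrices κ P G) := by
  unfold superCost
  congr 1
  ext c
  constructor
  · rintro ⟨f, γ, hγ, h, rfl⟩
    exact ⟨P f, ⟨f, trades γ, hγ.trades, fun ω => (h ω).trans_eq (portfolioValue_eq ..), rfl⟩, rfl⟩
  · rintro ⟨_, ⟨f, δ, hδ, h, rfl⟩, rfl⟩
    refine ⟨f, positions δ, hδ.positions, fun ω => ?_, rfl⟩
    rw [portfolioValue_eq, trades_positions]
    exact h ω

lemma le_superCost_iff {G : PathSpace N → ℝ} {a : ℝ} :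
    (a : EReal) ≤ superCost κ P G ↔ ∀ c ∈ hedgePrices κ P G, a ≤ c := by
  simp [superCost_eq]

lemma hedgePrices_anti {G G' : PathSpace N → ℝ} (h : G ≤ G') :
    hedgePrices κ P G' ⊆ hedgePrices κ P G := by
  rintro c ⟨f, δ, hδ, hd, rfl⟩
  exact ⟨f, δ, hδ, fun ω => (h ω).trans (hd ω), rfl⟩

lemma gain_zero (ω : PathSpace N) : gain κ 0 ω = 0 := by simp [gain]

/-- Opposite trades net out, so executing two strategies together can only save transaction costs.
-/
lemma gain_add_le (hκ : 0 ≤ κ) (δ δ' : Fin N → PathSpace N → ℝ) (ω : PathSpace N) :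
    gain κ δ ω + gain κ δ' ω ≤ gain κ (δ + δ') ω := by
  simp only [gain, ← Finset.sum_add_distrib, Pi.add_apply]
  refine Finset.sum_le_sum fun i _ => ?_
  have := mul_le_mul_of_nonneg_left (abs_add_le (δ i ω) (δ' i ω))
    (mul_nonneg hκ (price_nonneg i.castSucc ω))
  linarith

lemma gain_smul {a : ℝ} (ha : 0 ≤ a) (δ : Fin N → PathSpace N → ℝ) (ω : PathSpace N) :
    gain κ (a • δ) ω = a * gain κ δ ω := by
  simp only [gain, Finset.mul_sum, Pi.smul_apply, smul_eq_mul, abs_mul, abs_of_nonneg ha]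
  exact Finset.sum_congr rfl fun i _ => by ring

lemma exists_mem_hedgePrices_add (hP : IsPricing p P) (hκ : 0 ≤ κ) {G G' : PathSpace N → ℝ}
    {c c' : ℝ} (hc : c ∈ hedgePrices κ P G) (hc' : c' ∈ hedgePrices κ P G') :
    ∃ d ∈ hedgePrices κ P (G + G'), d ≤ c + c' := by
  obtain ⟨f, δ, hδ, hd, rfl⟩ := hc
  obtain ⟨f', δ', hδ', hd', rfl⟩ := hc'
  refine ⟨_, ⟨f + f', δ + δ', fun i ω ω' h => ?_, fun ω => ?_, rfl⟩, hP.map_add_le f f'⟩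
  · simp [hδ i ω ω' h, hδ' i ω ω' h]
  · have := gain_add_le hκ δ δ' ω
    have h1 := hd ω
    have h2 := hd' ω
    simp only [Pi.add_apply, Submodule.coe_add]
    linarith

lemma mul_mem_hedgePrices_smul (hP : IsPricing p P) {G : PathSpace N → ℝ} {a c : ℝ} (ha : 0 < a)
    (hc : c ∈ hedgePrices κ P G) : a * c ∈ hedgePrices κ P (a • G) := by
  obtain ⟨f, δ, hδ, hd, rfl⟩ := hc
  refine ⟨a • f, a • δ, fun i ω ω' h => ?_, fun ω => ?_, (hP.homogeneous a f ha).symm⟩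
  · simp [hδ i ω ω' h]
  · rw [gain_smul ha.le]
    have := mul_le_mul_of_nonneg_left (hd ω) ha.le
    simp only [Pi.smul_apply, smul_eq_mul, Submodule.coe_smul]
    linarith

lemma isProgressive_zero : IsProgressive (0 : Fin N → PathSpace N → ℝ) := fun _ _ _ _ => rfl

lemma apply_mem_hedgePrices (f : optionSpace p) :
    P f ∈ hedgePrices κ P (fun ω : PathSpace N => f.1 (terminal ω)) :=
  ⟨f, 0, isProgressive_zero, fun ω => by rw [gain_zero, add_zero], rfl⟩

lemma const_mem_hedgePrices (hP : IsPricing p P) (a : ℝ) :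
    a ∈ hedgePrices κ P (fun _ : PathSpace N => a) := by
  have h := apply_mem_hedgePrices (κ := κ) (N := N) (P := P) (constOption p a)
  rwa [hP.const] at h

lemma zero_mem_hedgePrices_gain (hP : IsPricing p P) {δ : Fin N → PathSpace N → ℝ}
    (hδ : IsProgressive δ) : (0 : ℝ) ∈ hedgePrices κ P (gain κ δ) :=
  ⟨0, δ, hδ, fun ω => by simp, hP.map_zero.symm⟩

/-- The quadratic function `1 + ∑ S_k²` of the path. -/
def sqGrowth (ω : PathSpace N) : ℝ := 1 + ∑ k : Fin (N + 1), price k ω ^ 2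

lemma one_le_sqGrowth (ω : PathSpace N) : 1 ≤ sqGrowth ω := by
  have : 0 ≤ ∑ k : Fin (N + 1), price k ω ^ 2 := Finset.sum_nonneg fun k _ => sq_nonneg _
  unfold sqGrowth; linarith

lemma sq_price_le_sqGrowth (k : Fin (N + 1)) (ω : PathSpace N) : price k ω ^ 2 ≤ sqGrowth ω := by
  have := Finset.single_le_sum (f := fun k : Fin (N + 1) => price k ω ^ 2)
    (fun k _ => sq_nonneg _) (Finset.mem_univ k)
  unfold sqGrowth; linarith

lemma pathNorm_sq_le_sqGrowth (ω : PathSpace N) : 1 + pathNorm ω ^ 2 ≤ sqGrowth ω := by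
  obtain ⟨k, -, hk⟩ := Finset.exists_mem_eq_sup Finset.univ Finset.univ_nonempty ω.1
  have := Finset.single_le_sum (f := fun k : Fin (N + 1) => price k ω ^ 2)
    (fun k _ => sq_nonneg _) (Finset.mem_univ k)
  rw [pathNorm, hk]
  exact add_le_add le_rfl this

/-- Static positions that are quadratic in the terminal price. -/
def quadraticOption (hp : 2 ≤ p) (a b : ℝ) : optionSpace p :=
  ⟨fun x => a + b * (x : ℝ) ^ 2, by fun_prop, |a| + 2 * |b| + 1, by positivity, fun x => by
    have hx0 : (0 : ℝ) ≤ x := x.2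
    have hxp : (0 : ℝ) ≤ (x : ℝ) ^ p := Real.rpow_nonneg hx0 p
    have hx : (x : ℝ) ^ 2 ≤ 1 + (x : ℝ) ^ p := by
      rcases le_total (x : ℝ) 1 with h | h
      · have := pow_le_one₀ hx0 h (n := 2)
        linarith
      · have := Real.rpow_le_rpow_of_exponent_le h hp
        rw [Real.rpow_two] at this
        linarith
    have h1 := abs_add_le a (b * (x : ℝ) ^ 2)
    rw [abs_mul, abs_of_nonneg (sq_nonneg (x : ℝ))] at h1
    have h2 := mul_le_mul_of_nonneg_left hx (abs_nonneg b)
    have h3 := mul_nonneg (abs_nonneg a) hxp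
    have h4 := mul_nonneg (abs_nonneg b) hxp
    have h5 := abs_nonneg b
    linarith⟩

/-- Selling 4 S_i shares at time i gains 4(1 - κ) S_i² - 4 S_i S_N ≥ 3 S_i² - 4 S_i S_N ≥ S_i² - 2
S_N², where κ ≤ 1/4 gives the first bound. The N terms 2 S_N², together with the summand S_N² of the
claim, explain the coefficient 2N + 1. -/
lemma hedgePrices_sqGrowth_nonempty (hp : 2 ≤ p) (hκ : κ ≤ 1 / 4) :
    (hedgePrices κ P (sqGrowth (N := N))).Nonempty := by
  refine ⟨_, quadraticOption hp 1 (2 * N + 1), fun i ω => -(4 * price i.castSucc ω),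
    fun i ω ω' h => by simp only [price, h i.castSucc le_rfl], fun ω => ?_, rfl⟩
  have hterm : price (Fin.last N) ω = (terminal ω : ℝ) := rfl
  have hsum : ∑ k : Fin (N + 1), price k ω ^ 2
      = ∑ i : Fin N, price i.castSucc ω ^ 2 + price (Fin.last N) ω ^ 2 := Fin.sum_univ_castSucc _
  have hgain : ∑ i : Fin N, (price i.castSucc ω ^ 2 - 2 * price (Fin.last N) ω ^ 2)
      ≤ gain κ (fun i ω => -(4 * price i.castSucc ω)) ω := by
    refine Finset.sum_le_sum fun i _ => ?_
    have h0 := price_nonneg i.castSucc ω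
    rw [abs_neg, abs_of_nonneg (by positivity)]
    nlinarith [sq_nonneg (price (Fin.last N) ω - price i.castSucc ω),
      mul_le_mul_of_nonneg_right hκ (sq_nonneg (price i.castSucc ω))]
  rw [Finset.sum_sub_distrib] at hgain
  simp only [Finset.sum_const, Finset.card_univ, Fintype.card_fin, nsmul_eq_mul] at hgain
  simp only [sqGrowth, hsum, quadraticOption, ← hterm]
  linarith

lemma hedgePrices_nonempty_of_le (hP : IsPricing p P) (hp : 2 ≤ p) (hκ : κ ≤ 1 / 4)
    {G : PathSpace N → ℝ} {C : ℝ} (hC : 0 < C) (h : ∀ ω, G ω ≤ C * sqGrowth ω) :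
    (hedgePrices κ P G).Nonempty := by
  obtain ⟨c, hc⟩ := hedgePrices_sqGrowth_nonempty (N := N) (P := P) hp hκ
  exact ⟨_, hedgePrices_anti h (mul_mem_hedgePrices_smul hP hC hc)⟩

/-- An arbitrage makes hedging arbitrarily cheap. -/
lemma exists_mem_hedgePrices_lt (hP : IsPricing p P) (hκ : 0 ≤ κ) {G : PathSpace N → ℝ} {c : ℝ}
    (hc : c ∈ hedgePrices κ P (0 : PathSpace N → ℝ)) (hc0 : c < 0)
    (hG : (hedgePrices κ P G).Nonempty) (x : ℝ) : ∃ d ∈ hedgePrices κ P G, d < x := by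
  obtain ⟨e, he⟩ := hG
  -- Scaling the arbitrage by this factor contributes -(|e - x| + 1), which brings the total below
  -- x.
  have hpos : 0 < (|e - x| + 1) / (-c) := div_pos (by positivity) (by linarith)
  obtain ⟨d, hd, hle⟩ := exists_mem_hedgePrices_add hP hκ he (mul_mem_hedgePrices_smul hP hpos hc)
  rw [smul_zero, add_zero] at hd
  refine ⟨d, hd, ?_⟩
  have : (|e - x| + 1) / (-c) * c = -(|e - x| + 1) := by
    have : c ≠ 0 := hc0.ne
    field_simp
  rw [this] at hle
  linarith [le_abs_self (e - x)]

lemma noModelIndependentArbitrage_iff :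
    NoModelIndependentArbitrage N κ P ↔ ∀ c ∈ hedgePrices κ P (0 : PathSpace N → ℝ), 0 ≤ c := by
  constructor
  · intro h
    have h0 := h 0 ⟨upperSemicontinuous_const, 1, one_pos, fun ω => ?_⟩ fun _ => le_rfl
    · exact le_superCost_iff.1 (by exact_mod_cast h0)
    · simp only [Pi.zero_apply, abs_zero]; positivity
  · intro h G _ hG
    have := le_superCost_iff.2 fun c hc => h c (hedgePrices_anti hG hc)
    exact_mod_cast this

end Hedging

/-! ### Weak duality -/

section WeakDuality

variable {N : ℕ} {κ p : ℝ} {P : optionSpace p → ℝ}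

lemma isClosed_pathSpace : IsClosed {ω : Fin (N + 1) → ℝ≥0 | ω 0 = 1} :=
  isClosed_eq (continuous_apply 0) continuous_const

instance : StandardBorelSpace (PathSpace N) := isClosed_pathSpace.measurableSet.standardBorel

/-- The prices up to time `k`. -/
def pastPrices (k : Fin (N + 1)) (ω : PathSpace N) (j : Set.Iic k) : ℝ := price j.1 ω

lemma continuous_pastPrices (k : Fin (N + 1)) : Continuous (pastPrices (N := N) k) :=
  continuous_pi fun j => continuous_price j.1

lemma canonicalFiltration_eq_comap (k : Fin (N + 1)) :
    canonicalFiltration N k = MeasurableSpace.comap (pastPrices k) inferInstance :=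
  Filtration.natural_eq_comap _ _ k

lemma IsProgressive.eq_of_pastPrices_eq {δ : Fin N → PathSpace N → ℝ} (hδ : IsProgressive δ)
    {i : Fin N} {k : Fin (N + 1)} (hik : i.castSucc ≤ k) {ω ω' : PathSpace N}
    (h : pastPrices k ω = pastPrices k ω') : δ i ω = δ i ω' :=
  hδ i ω ω' fun j hj => NNReal.coe_injective (congrFun h ⟨j, hj.trans hik⟩)

/-- Backward elimination of trades. The bound on X is affine in M with coefficients known at the
last trading date, so conditioning there keeps its form, with X and M replaced by their conditional
expectations. Since only X and M must be integrable, no integrability of δ is needed. -/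
lemma integral_nonpos_of_le_gain {Q : Measure (PathSpace N)} [IsProbabilityMeasure Q]
    {δ : Fin N → PathSpace N → ℝ} (hδ : IsProgressive δ) (n : ℕ) (hn : n ≤ N) :
    ∀ X M : PathSpace N → ℝ, Integrable X Q → Integrable M Q →
      (∀ i : Fin N, (i : ℕ) < n → ∀ᵐ ω ∂Q, |(Q[M | canonicalFiltration N i.castSucc]) ω
        - price i.castSucc ω| ≤ κ * price i.castSucc ω) →
      (∀ᵐ ω ∂Q, X ω ≤ ∑ i ∈ ({i : Fin N | (i : ℕ) < n} : Finset (Fin N)),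
        (δ i ω * (M ω - price i.castSucc ω) - κ * (price i.castSucc ω * |δ i ω|))) →
      ∫ ω, X ω ∂Q ≤ 0 := by
  induction n with
  | zero =>
    intro X M _ _ _ h
    refine integral_nonpos_of_ae ?_
    filter_upwards [h] with ω hω
    simpa using hω
  | succ n ih =>
    intro X M hX hM hMS h
    let k : Fin N := ⟨n, hn⟩
    have hmem : ∀ i ∈ ({i : Fin N | (i : ℕ) < n + 1} : Finset (Fin N)),
        i.castSucc ≤ k.castSucc := by
      intro i hi
      simp only [Finset.mem_filter, Finset.mem_univ, true_and] at hi
      exact Nat.lt_succ_iff.1 hi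
    have hle := (canonicalFiltration N).le k.castSucc
    have hpast : ∀ i ∈ ({i : Fin N | (i : ℕ) < n + 1} : Finset (Fin N)), ∀ ω ω' : PathSpace N,
        pastPrices k.castSucc ω = pastPrices k.castSucc ω' →
          price i.castSucc ω = price i.castSucc ω' :=
      fun i hi ω ω' hω => congrFun hω ⟨i.castSucc, hmem i hi⟩
    have hcond := condExp_le_mul_condExp_add (continuous_pastPrices k.castSucc).measurable hX hM
      (A := fun ω => ∑ i ∈ ({i : Fin N | (i : ℕ) < n + 1} : Finset (Fin N)), δ i ω)
      (B := fun ω => ∑ i ∈ ({i : Fin N | (i : ℕ) < n + 1} : Finset (Fin N)),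
        (-(δ i ω * price i.castSucc ω) - κ * (price i.castSucc ω * |δ i ω|)))
      (fun ω ω' hω => Finset.sum_congr rfl fun i hi => hδ.eq_of_pastPrices_eq (hmem i hi) hω)
      (fun ω ω' hω => Finset.sum_congr rfl fun i hi => by
        rw [hδ.eq_of_pastPrices_eq (hmem i hi) hω, hpast i hi ω ω' hω])
      (by
        filter_upwards [h] with ω hω
        refine hω.trans_eq ?_
        rw [Finset.sum_mul, ← Finset.sum_add_distrib]
        exact Finset.sum_congr rfl fun i _ => by ring)
    rw [← canonicalFiltration_eq_comap] at hcond
    rw [← integral_condExp hle]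
    refine ih (Nat.le_of_succ_le hn) _ (Q[M | canonicalFiltration N k.castSucc])
      integrable_condExp integrable_condExp (fun i hi => ?_) ?_
    -- The tower property preserves the price bounds at the earlier dates.
    · filter_upwards [hMS i (by omega), condExp_condExp_of_le (μ := Q) (f := M)
        ((canonicalFiltration N).mono (show i.castSucc ≤ k.castSucc from hi.le)) hle] with ω h1 h2
      rwa [h2]
    · filter_upwards [hcond, hMS k (Nat.lt_succ_self n)] with ω h1 h2
      refine h1.trans ?_
      have hins : ({i : Fin N | (i : ℕ) < n + 1} : Finset (Fin N))
          = insert k ({i : Fin N | (i : ℕ) < n} : Finset (Fin N)) := by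
        ext i
        simp only [Finset.mem_filter, Finset.mem_univ, true_and, Finset.mem_insert, Fin.ext_iff, k]
        omega
      have hk : k ∉ ({i : Fin N | (i : ℕ) < n} : Finset (Fin N)) := by simp [k]
      -- After conditioning, the expected profit of the last trade is at most its transaction cost.
      have hlast : δ k ω * ((Q[M | canonicalFiltration N k.castSucc]) ω - price k.castSucc ω)
          - κ * (price k.castSucc ω * |δ k ω|) ≤ 0 := by
        have h3 := le_abs_self
          (δ k ω * ((Q[M | canonicalFiltration N k.castSucc]) ω - price k.castSucc ω))
        rw [abs_mul] at h3
        have h4 := mul_le_mul_of_nonneg_left h2 (abs_nonneg (δ k ω))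
        linarith
      rw [Finset.sum_mul, ← Finset.sum_add_distrib, hins, Finset.sum_insert hk]
      have hrest : ∑ i ∈ ({i : Fin N | (i : ℕ) < n} : Finset (Fin N)),
          (δ i ω * (Q[M | canonicalFiltration N k.castSucc]) ω + (-(δ i ω * price i.castSucc ω)
            - κ * (price i.castSucc ω * |δ i ω|)))
          = ∑ i ∈ ({i : Fin N | (i : ℕ) < n} : Finset (Fin N)),
            (δ i ω * ((Q[M | canonicalFiltration N k.castSucc]) ω - price i.castSucc ω)
              - κ * (price i.castSucc ω * |δ i ω|)) :=
        Finset.sum_congr rfl fun i _ => by ring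
      rw [hrest]
      linarith

/-- Weak duality. -/
lemma integral_le_of_mem_hedgePrices {Q : Measure (PathSpace N)} (hQ : Q ∈ consistentLaws N κ P)
    {G : PathSpace N → ℝ} (hG : Integrable G Q) {c : ℝ} (hc : c ∈ hedgePrices κ P G) :
    ∫ ω, G ω ∂Q ≤ c := by
  obtain ⟨⟨hprob, hint, hcps⟩, hP⟩ := hQ
  obtain ⟨f, δ, hδ, hd, rfl⟩ := hc
  have h := integral_nonpos_of_le_gain (κ := κ) hδ N le_rfl
    (fun ω => G ω - f.1 (terminal ω)) (price (Fin.last N)) (hG.sub (hP f).1) hint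
    (fun i _ => by
      filter_upwards [hcps i.castSucc (Fin.castSucc_lt_last i)] with ω hω
      rw [abs_le]
      constructor <;> linarith [hω.1, hω.2])
    (ae_of_all _ fun ω => by
      have := hd ω
      simp only [Fin.is_lt, Finset.filter_true]
      unfold gain at this
      linarith)
  rw [integral_sub hG (hP f).1] at h
  linarith [(hP f).2]

end WeakDuality

/-! ### A linear functional below the hedging cost, and its representing measure -/

section PricingFunctional

open scoped BoundedContinuousFunction CompactlySupported Pointwise

variable {N : ℕ} {κ p : ℝ} {P : optionSpace p → ℝ}

/-- The space of claims that can be dominated from above and from below by portfolios. -/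
def hedgeable (N : ℕ) (hP : IsPricing p P) (hκ : 0 ≤ κ) : Submodule ℝ (PathSpace N → ℝ) where
  carrier := {G | (hedgePrices κ P G).Nonempty ∧ (hedgePrices κ P (-G)).Nonempty}
  zero_mem' := by
    have h := const_mem_hedgePrices (κ := κ) (N := N) hP 0
    exact ⟨⟨0, h⟩, ⟨0, by rw [neg_zero]; exact h⟩⟩
  add_mem' := by
    rintro G G' ⟨⟨a, ha⟩, ⟨b, hb⟩⟩ ⟨⟨a', ha'⟩, ⟨b', hb'⟩⟩
    obtain ⟨c, hc, -⟩ := exists_mem_hedgePrices_add hP hκ ha ha'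
    obtain ⟨d, hd, -⟩ := exists_mem_hedgePrices_add hP hκ hb hb'
    exact ⟨⟨c, hc⟩, ⟨d, by rwa [neg_add]⟩⟩
  smul_mem' := by
    rintro r G ⟨⟨a, ha⟩, ⟨b, hb⟩⟩
    rcases lt_trichotomy r 0 with hr | rfl | hr
    · refine ⟨⟨-r * b, ?_⟩, ⟨-r * a, ?_⟩⟩
      · simpa using mul_mem_hedgePrices_smul hP (neg_pos.2 hr) hb
      · simpa using mul_mem_hedgePrices_smul hP (neg_pos.2 hr) ha
    · have h := const_mem_hedgePrices (κ := κ) (N := N) hP 0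
      rw [zero_smul]
      exact ⟨⟨0, h⟩, ⟨0, by rw [neg_zero]; exact h⟩⟩
    · refine ⟨⟨r * a, mul_mem_hedgePrices_smul hP hr ha⟩, ⟨r * b, ?_⟩⟩
      simpa using mul_mem_hedgePrices_smul hP hr hb

lemma mem_hedgeable_of_abs_le (hP : IsPricing p P) (hp : 2 ≤ p) (hκ0 : 0 ≤ κ) (hκ : κ ≤ 1 / 4)
    {G : PathSpace N → ℝ} {C : ℝ} (h : ∀ ω, |G ω| ≤ C * sqGrowth ω) :
    G ∈ hedgeable N hP hκ0 := by
  have h' : ∀ ω, |G ω| ≤ (|C| + 1) * sqGrowth ω := fun ω => (h ω).trans <| by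
    have := one_le_sqGrowth ω
    gcongr
    linarith [le_abs_self C]
  exact ⟨hedgePrices_nonempty_of_le hP hp hκ (by positivity)
      fun ω => (le_abs_self _).trans (h' ω),
    hedgePrices_nonempty_of_le hP hp hκ (by positivity)
      fun ω => (neg_le_abs _).trans (h' ω)⟩

lemma option_mem_hedgeable (hP : IsPricing p P) (hκ : 0 ≤ κ) (f : optionSpace p) :
    (fun ω => f.1 (terminal ω)) ∈ hedgeable N hP hκ :=
  ⟨⟨_, apply_mem_hedgePrices f⟩, ⟨_, apply_mem_hedgePrices (-f)⟩⟩

/-- Hedges of G and of -G add up to a hedge of 0, which cannot have negative cost. -/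
lemma bddBelow_hedgePrices (hP : IsPricing p P) (hκ : 0 ≤ κ)
    (h0 : ∀ c ∈ hedgePrices κ P (0 : PathSpace N → ℝ), 0 ≤ c) {G : PathSpace N → ℝ}
    (hG : (hedgePrices κ P (-G)).Nonempty) : BddBelow (hedgePrices κ P G) := by
  obtain ⟨b, hb⟩ := hG
  refine ⟨-b, fun c hc => ?_⟩
  obtain ⟨d, hd, hle⟩ := exists_mem_hedgePrices_add hP hκ hc hb
  rw [add_neg_cancel] at hd
  linarith [h0 d hd]

lemma sInf_hedgePrices_add_le (hP : IsPricing p P) (hκ : 0 ≤ κ)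
    (h0 : ∀ c ∈ hedgePrices κ P (0 : PathSpace N → ℝ), 0 ≤ c) {G G' : PathSpace N → ℝ}
    (hG : G ∈ hedgeable N hP hκ) (hG' : G' ∈ hedgeable N hP hκ) :
    sInf (hedgePrices κ P (G + G')) ≤ sInf (hedgePrices κ P G) + sInf (hedgePrices κ P G') := by
  refine le_of_forall_pos_le_add fun ε hε => ?_
  obtain ⟨c, hc, hc'⟩ := exists_lt_of_csInf_lt hG.1
    (show sInf (hedgePrices κ P G) < sInf (hedgePrices κ P G) + ε / 2 by linarith)
  obtain ⟨d, hd, hd'⟩ := exists_lt_of_csInf_lt hG'.1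
    (show sInf (hedgePrices κ P G') < sInf (hedgePrices κ P G') + ε / 2 by linarith)
  obtain ⟨e, he, hle⟩ := exists_mem_hedgePrices_add hP hκ hc hd
  have := csInf_le (bddBelow_hedgePrices hP hκ h0 ((hedgeable N hP hκ).add_mem hG hG').2) he
  linarith

lemma sInf_hedgePrices_smul (hP : IsPricing p P) {G : PathSpace N → ℝ} {r : ℝ} (hr : 0 < r) :
    sInf (hedgePrices κ P (r • G)) = r * sInf (hedgePrices κ P G) := by
  have h : hedgePrices κ P (r • G) = r • hedgePrices κ P G := by
    ext c
    rw [Set.mem_smul_set_iff_inv_smul_mem₀ hr.ne']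
    constructor
    · intro hc
      simpa [smul_smul, hr.ne'] using mul_mem_hedgePrices_smul hP (inv_pos.2 hr) hc
    · intro hc
      simpa [hr.ne'] using mul_mem_hedgePrices_smul hP hr hc
  rw [h, Real.sInf_smul_of_nonneg hr.le, smul_eq_mul]

lemma sInf_hedgePrices_zero (hP : IsPricing p P)
    (h0 : ∀ c ∈ hedgePrices κ P (0 : PathSpace N → ℝ), 0 ≤ c) :
    sInf (hedgePrices κ P (0 : PathSpace N → ℝ)) = 0 :=
  have h := const_mem_hedgePrices (κ := κ) (N := N) hP 0
  le_antisymm (csInf_le ⟨0, h0⟩ h) (le_csInf ⟨0, h⟩ h0)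

/-- The linear functional `ℓ` prices every hedgeable claim at no more than its hedging costs. -/
def PricesBelowCost (κ : ℝ) (P : optionSpace p → ℝ) (ℓ : (PathSpace N → ℝ) →ₗ[ℝ] ℝ) : Prop :=
  ∀ G, (hedgePrices κ P (-G)).Nonempty → ∀ c ∈ hedgePrices κ P G, ℓ G ≤ c

/-- Hahn–Banach from the line spanned by G, with the cost as dominating sublinear functional. The
extension to all functions on path space is arbitrary off `hedgeable` and only spares the subtype.
-/
theorem exists_pricesBelowCost (hP : IsPricing p P) (hκ : 0 ≤ κ)
    (h0 : ∀ c ∈ hedgePrices κ P (0 : PathSpace N → ℝ), 0 ≤ c) {G : PathSpace N → ℝ}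
    (hG : G ∈ hedgeable N hP hκ) :
    ∃ ℓ : (PathSpace N → ℝ) →ₗ[ℝ] ℝ, PricesBelowCost κ P ℓ ∧ ℓ G = sInf (hedgePrices κ P G) := by
  let E := hedgeable N hP hκ
  let V : E → ℝ := fun x => sInf (hedgePrices κ P x.1)
  have hV0 : sInf (hedgePrices κ P (0 : PathSpace N → ℝ)) = 0 := sInf_hedgePrices_zero hP h0
  have hVsmul : ∀ r : ℝ, 0 < r → ∀ x : E, V (r • x) = r * V x := fun r hr x =>
    sInf_hedgePrices_smul hP hr
  have hVneg : ∀ x : E, 0 ≤ V x + V (-x) := fun x => by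
    have := sInf_hedgePrices_add_le hP hκ h0 x.2 (-x).2
    rwa [Submodule.coe_neg, add_neg_cancel, hV0] at this
  let x₀ : E := ⟨G, hG⟩
  have hx₀ : ∀ r : ℝ, r • x₀ = 0 → r • V x₀ = 0 := by
    intro r hr
    rcases smul_eq_zero.1 hr with rfl | h
    · exact zero_smul _ _
    · have : V x₀ = 0 := by rw [h]; exact hV0
      rw [this, smul_zero]
  obtain ⟨g, hg, hgV⟩ := exists_extension_of_le_sublinear
    (LinearPMap.mkSpanSingleton' x₀ (V x₀) hx₀) V hVsmul
    (fun x y => sInf_hedgePrices_add_le hP hκ h0 x.2 y.2) (by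
      rintro ⟨y, hy⟩
      obtain ⟨r, rfl⟩ := Submodule.mem_span_singleton.1 hy
      rw [LinearPMap.mkSpanSingleton'_apply, smul_eq_mul]
      rcases lt_trichotomy r 0 with hr | rfl | hr
      -- For negative r, domination follows from 0 ≤ V(y) + V(-y), a consequence of sublinearity.
      · have h1 := hVsmul (-r) (neg_pos.2 hr) x₀
        have h2 := hVneg (r • x₀)
        have h3 : V (-(r • x₀)) = -r * V x₀ := (congrArg V (neg_smul r x₀).symm).trans h1
        have h4 : r * V x₀ ≤ V (r • x₀) := by linarith
        exact h4
      · have h1 : (0 : ℝ) * V x₀ ≤ V ((0 : ℝ) • x₀) := by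
          rw [zero_mul, zero_smul]
          exact hV0.ge
        exact h1
      · exact (hVsmul r hr x₀).ge)
  obtain ⟨ℓ, hℓ⟩ := g.exists_extend
  have hext : ∀ x : E, ℓ x.1 = g x := fun x => by rw [← hℓ]; rfl
  refine ⟨ℓ, fun G' hne c hc => ?_, ?_⟩
  · have h1 := hgV ⟨G', ⟨c, hc⟩, hne⟩
    rw [← hext] at h1
    exact h1.trans (csInf_le (bddBelow_hedgePrices hP hκ h0 hne) hc)
  · have h1 := hg ⟨x₀, Submodule.mem_span_singleton_self _⟩
    exact (hext x₀).trans (h1.trans (LinearPMap.mkSpanSingleton'_apply_self ..))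

variable {ℓ : (PathSpace N → ℝ) →ₗ[ℝ] ℝ}

/-- The nonpositive claim G - G' is dominated by doing nothing, at cost 0. -/
lemma PricesBelowCost.map_le_of_le (hℓ : PricesBelowCost κ P ℓ) (hP : IsPricing p P) (hκ : 0 ≤ κ)
    {G G' : PathSpace N → ℝ} (hG : G ∈ hedgeable N hP hκ) (hG' : G' ∈ hedgeable N hP hκ)
    (h : G ≤ G') : ℓ G ≤ ℓ G' := by
  rw [← sub_nonpos, ← map_sub]
  refine hℓ _ ((hedgeable N hP hκ).sub_mem hG hG').2 0
    (hedgePrices_anti (G' := fun _ => 0) ?_ (const_mem_hedgePrices hP 0))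
  exact fun ω => sub_nonpos.2 (h ω)

lemma PricesBelowCost.map_one (hℓ : PricesBelowCost κ P ℓ) (hP : IsPricing p P) :
    ℓ (fun _ => 1) = 1 := by
  have h := fun a : ℝ => const_mem_hedgePrices (κ := κ) (N := N) hP a
  refine le_antisymm (hℓ _ ⟨-1, h (-1)⟩ 1 (h 1)) ?_
  have h1 := hℓ (-fun _ => 1) ⟨1, by rw [neg_neg]; exact h 1⟩ (-1) (h (-1))
  rw [map_neg] at h1
  linarith

instance : LocallyCompactSpace (PathSpace N) :=
  isClosed_pathSpace.isClosedEmbedding_subtypeVal.locallyCompactSpace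

lemma continuous_sqGrowth : Continuous (sqGrowth (N := N)) :=
  continuous_const.add (continuous_finsetSum _ fun k _ => (continuous_price k).pow 2)

/-- A continuous cutoff: `1` where `sqGrowth ≤ n + 1` and `0` where `2 (n + 1) ≤ sqGrowth`. -/
noncomputable def cutoff (n : ℕ) (ω : PathSpace N) : ℝ := max 0 (min 1 (2 - sqGrowth ω / (n + 1)))

lemma continuous_cutoff (n : ℕ) : Continuous (cutoff (N := N) n) :=
  continuous_const.max (continuous_const.min
    (continuous_const.sub (continuous_sqGrowth.div_const _)))

lemma cutoff_nonneg (n : ℕ) (ω : PathSpace N) : 0 ≤ cutoff n ω := le_max_left _ _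

lemma cutoff_le_one (n : ℕ) (ω : PathSpace N) : cutoff n ω ≤ 1 :=
  max_le zero_le_one (min_le_left _ _)

lemma cutoff_eq_one {n : ℕ} {ω : PathSpace N} (h : sqGrowth ω ≤ n + 1) : cutoff n ω = 1 := by
  have h1 : sqGrowth ω / (n + 1) ≤ 1 := (div_le_one (by positivity)).2 h
  rw [cutoff, min_eq_left (by linarith), max_eq_right zero_le_one]

lemma tendsto_cutoff (ω : PathSpace N) : Tendsto (fun n => cutoff n ω) atTop (𝓝 1) := by
  obtain ⟨m, hm⟩ := exists_nat_ge (sqGrowth ω)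
  refine tendsto_const_nhds.congr' ?_
  filter_upwards [eventually_ge_atTop m] with n hn
  have : (m : ℝ) ≤ n := by exact_mod_cast hn
  exact (cutoff_eq_one (by linarith)).symm

lemma isCompact_sqGrowth_le (R : ℝ) : IsCompact {ω : PathSpace N | sqGrowth ω ≤ R} := by
  have h1 : IsCompact ((Subtype.val : PathSpace N → _) ⁻¹' Set.Icc 0 fun _ => R.toNNReal) :=
    isClosed_pathSpace.isClosedEmbedding_subtypeVal.isCompact_preimage isCompact_Icc
  refine h1.of_isClosed_subset (isClosed_le continuous_sqGrowth continuous_const) fun ω hω => ?_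
  refine ⟨fun _ => zero_le, fun k => ?_⟩
  have hR : 1 ≤ R := (one_le_sqGrowth ω).trans hω
  have hk : price k ω ^ 2 ≤ R := (sq_price_le_sqGrowth k ω).trans hω
  have hk' : price k ω ≤ R := by nlinarith [price_nonneg k ω]
  exact NNReal.le_toNNReal_of_coe_le hk'

lemma hasCompactSupport_mul_cutoff (G : PathSpace N → ℝ) (n : ℕ) :
    HasCompactSupport fun ω => G ω * cutoff n ω := by
  refine HasCompactSupport.intro (isCompact_sqGrowth_le (2 * (n + 1))) fun ω hω => ?_
  have h1 : 2 * ((n : ℝ) + 1) < sqGrowth ω := not_le.1 hω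
  have h2 : 2 ≤ sqGrowth ω / (n + 1) := (le_div_iff₀ (by positivity)).2 h1.le
  have h3 : cutoff n ω = 0 := by
    rw [cutoff, max_eq_left]
    exact (min_le_right _ _).trans (by linarith)
  rw [h3, mul_zero]

/-- A measure representing `ℓ` on the continuous functions with compact support. -/
theorem PricesBelowCost.exists_measure (hℓ : PricesBelowCost κ P ℓ) (hP : IsPricing p P)
    (hp : 2 ≤ p) (hκ0 : 0 ≤ κ) (hκ : κ ≤ 1 / 4) :
    ∃ Q : Measure (PathSpace N), IsFiniteMeasureOnCompacts Q ∧
      ∀ G : PathSpace N → ℝ, Continuous G → HasCompactSupport G → ∫ ω, G ω ∂Q = ℓ G := by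
  have hmem : ∀ f : C_c(PathSpace N, ℝ), ⇑f ∈ hedgeable N hP hκ0 := fun f => by
    obtain ⟨C, hC⟩ := f.hasCompactSupport.exists_bound_of_continuous f.continuous
    refine mem_hedgeable_of_abs_le hP hp hκ0 hκ (C := |C|) fun ω => (hC ω).trans ?_
    nlinarith [le_abs_self C, abs_nonneg C, one_le_sqGrowth ω]
  let Λ : C_c(PathSpace N, ℝ) →ₚ[ℝ] ℝ := PositiveLinearMap.mk₀
    { toFun := fun f => ℓ ⇑f
      map_add' := fun f g => map_add ℓ ⇑f ⇑g
      map_smul' := fun r f => map_smul ℓ r ⇑f }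
    (fun f hf => by
      have h := hℓ.map_le_of_le hP hκ0 (Submodule.zero_mem _) (hmem f) hf
      rwa [map_zero] at h)
  refine ⟨RealRMK.rieszMeasure Λ, inferInstance, fun G hG hGc => ?_⟩
  exact RealRMK.integral_rieszMeasure Λ ⟨⟨G, hG⟩, hGc⟩

/-- The representation extends to continuous functions that are at most linear in the path. -/
lemma PricesBelowCost.integrable_and_integral_eq (hℓ : PricesBelowCost κ P ℓ) (hP : IsPricing p P)
    (hp : 2 ≤ p) (hκ0 : 0 ≤ κ) (hκ : κ ≤ 1 / 4) {Q : Measure (PathSpace N)}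
    [IsFiniteMeasureOnCompacts Q]
    (hQ : ∀ G : PathSpace N → ℝ, Continuous G → HasCompactSupport G → ∫ ω, G ω ∂Q = ℓ G)
    {G : PathSpace N → ℝ} (hG : Continuous G) {C : ℝ} (hC : ∀ ω, |G ω| ≤ C * √(sqGrowth ω)) :
    Integrable G Q ∧ ∫ ω, G ω ∂Q = ℓ G := by
  have hC0 : 0 ≤ C := by
    have h1 := (abs_nonneg _).trans (hC (⟨fun _ => 1, rfl⟩ : PathSpace N))
    exact nonneg_of_mul_nonneg_left h1
      (Real.sqrt_pos.2 (zero_lt_one.trans_le (one_le_sqGrowth _)))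
  have hsqrt : ∀ ω : PathSpace N, √(sqGrowth ω) ≤ sqGrowth ω := fun ω =>
    Real.sqrt_le_iff.2 ⟨zero_le_one.trans (one_le_sqGrowth ω), by nlinarith [one_le_sqGrowth ω]⟩
  have hmem : ∀ {F : PathSpace N → ℝ}, (∀ ω, |F ω| ≤ |G ω|) → F ∈ hedgeable N hP hκ0 := fun hF =>
    mem_hedgeable_of_abs_le hP hp hκ0 hκ fun ω =>
      ((hF ω).trans (hC ω)).trans (mul_le_mul_of_nonneg_left (hsqrt ω) hC0)
  have hW : sqGrowth ∈ hedgeable N hP hκ0 := mem_hedgeable_of_abs_le hP hp hκ0 hκ (C := 1)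
    fun ω => by rw [one_mul, abs_of_nonneg (zero_le_one.trans (one_le_sqGrowth ω))]
  have hcut : ∀ (n : ℕ) (ω : PathSpace N), |G ω * cutoff n ω| ≤ |G ω| := fun n ω => by
    rw [abs_mul, abs_of_nonneg (cutoff_nonneg n ω)]
    exact mul_le_of_le_one_right (abs_nonneg _) (cutoff_le_one n ω)
  have hint : ∀ n, Integrable (fun ω => G ω * cutoff n ω) Q := fun n =>
    (hG.mul (continuous_cutoff n)).integrable_of_hasCompactSupport
      (hasCompactSupport_mul_cutoff G n)
  have hlim : ∀ ω, Tendsto (fun n => G ω * cutoff n ω) atTop (𝓝 (G ω)) := fun ω => by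
    simpa using (tendsto_cutoff ω).const_mul (G ω)
  have hGint : Integrable G Q := by
    -- Monotonicity of `ℓ` bounds the L¹ norms of all truncations by the value of `ℓ` at |G|.
    refine integrable_of_tendsto_of_integral_abs_le (C := ℓ fun ω => |G ω|) hint (fun n => ?_) hlim
    have h1 : (fun ω => |G ω * cutoff n ω|) = fun ω => |G ω| * cutoff n ω := by
      funext ω
      rw [abs_mul, abs_of_nonneg (cutoff_nonneg n ω)]
    rw [h1, hQ (fun ω => |G ω| * cutoff n ω) (hG.abs.mul (continuous_cutoff n))
      (hasCompactSupport_mul_cutoff _ n), ← h1]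
    exact hℓ.map_le_of_le hP hκ0 (hmem fun ω => by rw [abs_abs]; exact hcut n ω)
      (hmem fun ω => (abs_abs _).le) (hcut n)
  refine ⟨hGint, tendsto_nhds_unique (f := fun n => ∫ ω, G ω * cutoff n ω ∂Q) (l := atTop) ?_ ?_⟩
  · exact tendsto_integral_of_dominated_convergence (fun ω => |G ω|) (fun n => (hint n).1)
      hGint.abs (fun n => ae_of_all _ (hcut n)) (ae_of_all _ hlim)
  -- Linear growth is played against quadratic growth: where the cutoff is not 1, the square root of
  -- `sqGrowth` is at most `sqGrowth` divided by √(n + 1). As `ℓ sqGrowth` is a fixed number, `ℓ` of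
  -- the truncation error tends to 0.
  · have hbound : ∀ (n : ℕ) (ω : PathSpace N),
        |G ω - G ω * cutoff n ω| ≤ C / √(n + 1) * sqGrowth ω := fun n ω => by
      rcases le_total (sqGrowth ω) (n + 1) with h | h
      · rw [cutoff_eq_one h, mul_one, sub_self, abs_zero]
        have := zero_le_one.trans (one_le_sqGrowth ω)
        positivity
      · have h1 : |G ω - G ω * cutoff n ω| ≤ |G ω| := by
          rw [← mul_one_sub, abs_mul, abs_of_nonneg (sub_nonneg.2 (cutoff_le_one n ω))]
          exact mul_le_of_le_one_right (abs_nonneg _) (by linarith [cutoff_nonneg n ω])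
        refine (h1.trans (hC ω)).trans ?_
        rw [div_mul_eq_mul_div, mul_div_assoc]
        refine mul_le_mul_of_nonneg_left ?_ hC0
        rw [le_div_iff₀ (by positivity)]
        calc √(sqGrowth ω) * √(n + 1) ≤ √(sqGrowth ω) * √(sqGrowth ω) := by gcongr
          _ = sqGrowth ω := Real.mul_self_sqrt (zero_le_one.trans (one_le_sqGrowth ω))
    have hdiff : ∀ n : ℕ, ‖ℓ (fun ω => G ω * cutoff n ω) - ℓ G‖ ≤ C / √(n + 1) * ℓ sqGrowth := by
      intro n
      have hD : (fun ω => G ω - G ω * cutoff n ω) ∈ hedgeable N hP hκ0 :=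
        (hedgeable N hP hκ0).sub_mem (hmem fun ω => le_rfl) (hmem (hcut n))
      have hCW := (hedgeable N hP hκ0).smul_mem (C / √(n + 1)) hW
      have hD' : ℓ (fun ω => G ω - G ω * cutoff n ω) = ℓ G - ℓ (fun ω => G ω * cutoff n ω) :=
        map_sub ℓ G _
      have h1 := hℓ.map_le_of_le hP hκ0 hD hCW fun ω => (le_abs_self _).trans (hbound n ω)
      have h2 := hℓ.map_le_of_le hP hκ0 ((hedgeable N hP hκ0).neg_mem hD) hCW
        fun ω => (neg_le_abs _).trans (hbound n ω)
      rw [map_smul, smul_eq_mul, hD'] at h1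
      rw [map_smul, smul_eq_mul, map_neg, hD'] at h2
      rw [Real.norm_eq_abs, abs_le]
      constructor <;> linarith
    have hzero : Tendsto (fun n : ℕ => C / √((n : ℝ) + 1) * ℓ sqGrowth) atTop (𝓝 0) := by
      have h1 : Tendsto (fun n : ℕ => √((n : ℝ) + 1)) atTop atTop :=
        Real.tendsto_sqrt_atTop.comp
          (tendsto_atTop_add_const_right _ _ tendsto_natCast_atTop_atTop)
      simpa using (h1.const_div_atTop C).mul_const (ℓ sqGrowth)
    have h3 := squeeze_zero_norm hdiff hzero
    have h4 := h3.add_const (ℓ G)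
    simp only [sub_add_cancel, zero_add] at h4
    exact h4.congr fun n => (hQ _ (hG.mul (continuous_cutoff n))
      (hasCompactSupport_mul_cutoff G n)).symm

end PricingFunctional

/-! ### Extending the representation to all static positions -/

section StaticPositions

variable {N : ℕ} {κ p : ℝ} {P : optionSpace p → ℝ} {ℓ : (PathSpace N → ℝ) →ₗ[ℝ] ℝ}

/-- The functional `f ↦ ℓ (f (S_N))`. -/
def terminalFunctional (ℓ : (PathSpace N → ℝ) →ₗ[ℝ] ℝ) : (ℝ≥0 → ℝ) →ₗ[ℝ] ℝ :=
  ℓ.comp (LinearMap.funLeft ℝ ℝ terminal)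

lemma PricesBelowCost.terminalFunctional_le (hℓ : PricesBelowCost κ P ℓ) (f : optionSpace p) :
    terminalFunctional ℓ f.1 ≤ P f :=
  hℓ _ ⟨_, apply_mem_hedgePrices (-f)⟩ _ (apply_mem_hedgePrices f)

lemma continuous_terminal : Continuous (terminal (N := N)) :=
  (continuous_apply _).comp continuous_subtype_val

lemma IsPricing.eventually_lt_of_tendsto_zero (hP : IsPricing p P) {F : ℕ → optionSpace p} {C : ℝ}
    (hC : ∀ n x, |(F n).1 x| ≤ C * (1 + (x : ℝ) ^ p))
    (hF : ∀ x, Tendsto (fun n => (F n).1 x) atTop (𝓝 0)) {ε : ℝ} (hε : 0 < ε) :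
    ∀ᶠ n in atTop, P (F n) < ε := by
  have h1 := hP.limsup_le F 0 ⟨C, hC⟩ hF
  rw [hP.map_zero] at h1
  have h2 : limsup (fun n => ((P (F n) : ℝ) : EReal)) atTop < (ε : EReal) :=
    h1.trans_lt (by exact_mod_cast hε)
  filter_upwards [eventually_lt_of_limsup_lt h2] with n hn
  exact_mod_cast hn

/-- The limsup condition makes the functional continuous along dominated sequences. -/
lemma PricesBelowCost.tendsto_terminalFunctional (hℓ : PricesBelowCost κ P ℓ)
    (hP : IsPricing p P) {F : ℕ → ℝ≥0 → ℝ} {f : ℝ≥0 → ℝ} {C : ℝ} (hm : ∀ n, Measurable (F n))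
    (hC : ∀ n x, |F n x| ≤ C * (1 + (x : ℝ) ^ p))
    (hF : ∀ x, Tendsto (fun n => F n x) atTop (𝓝 (f x))) :
    Tendsto (fun n => terminalFunctional ℓ (F n)) atTop (𝓝 (terminalFunctional ℓ f)) := by
  have hfm : Measurable f := measurable_of_tendsto_metrizable hm (tendsto_pi_nhds.2 hF)
  have hfC : ∀ x, |f x| ≤ C * (1 + (x : ℝ) ^ p) := fun x =>
    le_of_tendsto' (hF x).abs fun n => hC n x
  have hw : ∀ x : ℝ≥0, 0 < 1 + (x : ℝ) ^ p := fun x => by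
    have := Real.rpow_nonneg x.2 p
    positivity
  have hD : ∀ n x, |F n x - f x| ≤ 2 * (|C| + 1) * (1 + (x : ℝ) ^ p) := fun n x => by
    have h1 := abs_sub (F n x) (f x)
    have h2 := mul_le_mul_of_nonneg_right (show C ≤ |C| + 1 by linarith [le_abs_self C]) (hw x).le
    linarith [hC n x, hfC x]
  let D : ℕ → optionSpace p := fun n =>
    ⟨F n - f, (hm n).sub hfm, 2 * (|C| + 1), by positivity, hD n⟩
  have hlim : ∀ x, Tendsto (fun n => (D n).1 x) atTop (𝓝 0) := fun x => by
    have h := (hF x).sub_const (f x)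
    rwa [sub_self] at h
  rw [Metric.tendsto_atTop']
  intro ε hε
  -- The condition on `P` is one-sided, so it is applied to the differences and to their negatives.
  have h1 := hP.eventually_lt_of_tendsto_zero (F := D) hD hlim hε
  have h2 := hP.eventually_lt_of_tendsto_zero (F := fun n => -D n) (C := 2 * (|C| + 1))
    (fun n x => by
      rw [Submodule.coe_neg, Pi.neg_apply, abs_neg]
      exact hD n x) (fun x => by simpa using (hlim x).neg) hε
  obtain ⟨n, hn⟩ := (h1.and h2).exists_forall_of_atTop
  refine ⟨n, fun m hm' => ?_⟩
  have h3 := (hℓ.terminalFunctional_le (D m)).trans_lt (hn m hm'.le).1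
  have h4 := (hℓ.terminalFunctional_le (-D m)).trans_lt (hn m hm'.le).2
  rw [Submodule.coe_neg, map_neg] at h4
  have h5 : terminalFunctional ℓ (D m).1
      = terminalFunctional ℓ (F m) - terminalFunctional ℓ f := map_sub _ _ _
  rw [h5] at h3 h4
  rw [Real.dist_eq, abs_lt]
  constructor <;> linarith

/-- `Q` represents `ℓ` on the static position `f`. -/
def Represents (Q : Measure (PathSpace N)) (ℓ : (PathSpace N → ℝ) →ₗ[ℝ] ℝ) (f : ℝ≥0 → ℝ) : Prop :=
  Integrable (fun ω => f (terminal ω)) Q ∧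
    terminalFunctional ℓ f = ∫ ω, f (terminal ω) ∂Q

variable {Q : Measure (PathSpace N)} {f g : ℝ≥0 → ℝ}

lemma Represents.add (hf : Represents Q ℓ f) (hg : Represents Q ℓ g) : Represents Q ℓ (f + g) := by
  refine ⟨hf.1.add hg.1, ?_⟩
  rw [map_add, hf.2, hg.2]
  exact (integral_add hf.1 hg.1).symm

lemma Represents.smul (hf : Represents Q ℓ f) (r : ℝ) : Represents Q ℓ (r • f) := by
  refine ⟨hf.1.const_mul r, ?_⟩
  rw [map_smul, hf.2]
  exact (integral_const_mul r _).symm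

lemma Represents.sub (hf : Represents Q ℓ f) (hg : Represents Q ℓ g) : Represents Q ℓ (f - g) := by
  have := hf.add (hg.smul (-1))
  rwa [neg_one_smul, ← sub_eq_add_neg] at this

lemma represents_zero : Represents Q ℓ 0 :=
  ⟨integrable_zero _ _ _, by rw [map_zero]; exact (integral_zero _ _).symm⟩

/-- Two dominations appear: growth of order x^p gives convergence under `ℓ`, while the bound b gives
dominated convergence under `Q`, for which integrability of S_N^p is not yet known. -/
lemma Represents.of_tendsto (hℓ : PricesBelowCost κ P ℓ) (hP : IsPricing p P) {F : ℕ → ℝ≥0 → ℝ}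
    {C : ℝ} (hm : ∀ n, Measurable (F n)) (hC : ∀ n x, |F n x| ≤ C * (1 + (x : ℝ) ^ p))
    (hlim : ∀ x, Tendsto (fun n => F n x) atTop (𝓝 (f x)))
    (hF : ∀ n, Represents Q ℓ (F n)) {b : ℝ≥0 → ℝ} (hb : Integrable (fun ω => b (terminal ω)) Q)
    (hbF : ∀ n x, |F n x| ≤ b x) : Represents Q ℓ f := by
  have hfm : Measurable f := measurable_of_tendsto_metrizable hm (tendsto_pi_nhds.2 hlim)
  constructor
  · refine hb.mono' (hfm.comp continuous_terminal.measurable).aestronglyMeasurable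
      (ae_of_all _ fun ω => ?_)
    exact le_of_tendsto' (hlim (terminal ω)).abs fun n => hbF n _
  · refine tendsto_nhds_unique (hℓ.tendsto_terminalFunctional hP hm hC hlim) ?_
    simp only [fun n => (hF n).2]
    exact tendsto_integral_of_dominated_convergence _ (fun n => (hF n).1.1) hb
      (fun n => ae_of_all _ fun ω => hbF n _) (ae_of_all _ fun ω => hlim _)

lemma Represents.of_tendsto_of_le_one [IsFiniteMeasure Q] (hℓ : PricesBelowCost κ P ℓ)
    (hP : IsPricing p P) {F : ℕ → ℝ≥0 → ℝ} (hm : ∀ n, Measurable (F n)) (hC : ∀ n x, |F n x| ≤ 1)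
    (hlim : ∀ x, Tendsto (fun n => F n x) atTop (𝓝 (f x)))
    (hF : ∀ n, Represents Q ℓ (F n)) : Represents Q ℓ f := by
  refine Represents.of_tendsto (C := 1) (b := fun _ => 1) hℓ hP hm (fun n x => ?_) hlim hF
    (integrable_const _) hC
  have := Real.rpow_nonneg x.2 p
  rw [one_mul]
  exact (hC n x).trans (le_add_of_nonneg_right this)

/-- A π-λ argument from closed sets, whose indicators are bounded limits of continuous functions. -/
theorem represents_indicator [IsFiniteMeasure Q] (hℓ : PricesBelowCost κ P ℓ) (hP : IsPricing p P)
    (hcont : ∀ φ : ℝ≥0 → ℝ, Continuous φ → (∀ x, |φ x| ≤ 1) → Represents Q ℓ φ)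
    {A : Set ℝ≥0} (hA : MeasurableSet A) : Represents Q ℓ (A.indicator fun _ => 1) := by
  have hone : Represents Q ℓ fun _ => 1 := hcont _ continuous_const (by simp)
  have hle : ∀ (A : Set ℝ≥0) (x : ℝ≥0), |A.indicator (fun _ => (1 : ℝ)) x| ≤ 1 := fun A x => by
    by_cases h : x ∈ A <;> simp [h]
  induction A, hA using MeasurableSpace.induction_on_inter
    (BorelSpace.measurable_eq.trans (borel_eq_generateFrom_isClosed (α := ℝ≥0))) isPiSystem_isClosed
    with
  | empty =>
    rw [Set.indicator_empty]
    exact represents_zero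
  | basic F hF =>
    have hF' : IsClosed F := hF
    refine Represents.of_tendsto_of_le_one hℓ hP (F := fun n x => (hF'.apprSeq n x : ℝ))
      (fun n => ?_) (fun n x => ?_) (fun x => ?_) fun n => ?_
    · exact (NNReal.continuous_coe.comp (hF'.apprSeq n).continuous).measurable
    · rw [abs_of_nonneg (NNReal.coe_nonneg _)]
      exact_mod_cast HasOuterApproxClosed.apprSeq_apply_le_one hF' n x
    · have h1 := tendsto_pi_nhds.1 (HasOuterApproxClosed.tendsto_apprSeq hF') x
      have h2 := (NNReal.continuous_coe.tendsto _).comp h1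
      have h3 : ((F.indicator (fun _ => (1 : ℝ≥0)) x : ℝ≥0) : ℝ)
          = F.indicator (fun _ => (1 : ℝ)) x := by
        by_cases h : x ∈ F <;> simp [h]
      rw [h3] at h2
      exact h2
    · refine hcont _ (NNReal.continuous_coe.comp (hF'.apprSeq n).continuous) fun x => ?_
      rw [abs_of_nonneg (NNReal.coe_nonneg _)]
      exact_mod_cast HasOuterApproxClosed.apprSeq_apply_le_one hF' n x
  | compl A hA ih =>
    rw [Set.indicator_compl]
    exact hone.sub ih
  | iUnion A hdisj hA ih =>
    -- By disjointness the partial sums are indicators, hence bounded by 1 uniformly in n.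
    have hsum : ∀ n : ℕ, (fun x => ∑ i ∈ Finset.range n, (A i).indicator (fun _ => (1 : ℝ)) x)
        = (⋃ i ∈ Finset.range n, A i).indicator fun _ => 1 := fun n =>
      (Finset.indicator_biUnion _ _ fun i _ j _ hij => hdisj hij).symm
    have hrep : ∀ n : ℕ, Represents Q ℓ
        fun x => ∑ i ∈ Finset.range n, (A i).indicator (fun _ => (1 : ℝ)) x := by
      intro n
      induction n with
      | zero =>
        simp only [Finset.range_zero, Finset.sum_empty]
        exact represents_zero
      | succ n ihn =>
        simp only [Finset.sum_range_succ]
        exact ihn.add (ih n)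
    refine Represents.of_tendsto_of_le_one hℓ hP
      (fun n => Finset.measurable_fun_sum _ fun i _ => measurable_const.indicator (hA i))
      (fun n x => ?_) (fun x => ?_) hrep
    · rw [congrFun (hsum n) x]
      exact hle _ x
    · by_cases hx : x ∈ ⋃ i, A i
      · obtain ⟨j, hj⟩ := Set.mem_iUnion.1 hx
        refine tendsto_const_nhds.congr' ?_
        filter_upwards [eventually_gt_atTop j] with n hn
        rw [congrFun (hsum n) x, Set.indicator_of_mem hx, Set.indicator_of_mem]
        exact Set.mem_biUnion (Finset.mem_coe.2 (Finset.mem_range.2 hn)) hj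
      · refine tendsto_const_nhds.congr fun n => ?_
        rw [congrFun (hsum n) x, Set.indicator_of_notMem hx, Set.indicator_of_notMem]
        exact fun h => hx (Set.iUnion₂_subset_iUnion _ _ h)

theorem represents_simpleFunc [IsFiniteMeasure Q] (hℓ : PricesBelowCost κ P ℓ) (hP : IsPricing p P)
    (hcont : ∀ φ : ℝ≥0 → ℝ, Continuous φ → (∀ x, |φ x| ≤ 1) → Represents Q ℓ φ)
    (s : SimpleFunc ℝ≥0 ℝ) : Represents Q ℓ s := by
  induction s using SimpleFunc.induction with
  | const c hs =>
    convert (represents_indicator hℓ hP hcont hs).smul c using 1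
    funext x
    simp [SimpleFunc.coe_piecewise, Set.piecewise, Set.indicator]
  | add hdisj hf hg => exact hf.add hg

/-- If `Q` represents `ℓ` on bounded continuous static positions, then it does so on all of `H`. -/
theorem represents_option [IsFiniteMeasure Q] (hℓ : PricesBelowCost κ P ℓ) (hP : IsPricing p P)
    (hκ : 0 ≤ κ) (hcont : ∀ φ : ℝ≥0 → ℝ, Continuous φ → (∀ x, |φ x| ≤ 1) → Represents Q ℓ φ)
    (f : optionSpace p) : Represents Q ℓ f.1 := by
  obtain ⟨hfm, C, hC, hfC⟩ := f.2
  let s : ℕ → SimpleFunc ℝ≥0 ℝ := fun n =>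
    SimpleFunc.approxOn f.1 hfm Set.univ 0 (Set.mem_univ 0) n
  have hlim : ∀ x, Tendsto (fun n => s n x) atTop (𝓝 (f.1 x)) := fun x =>
    SimpleFunc.tendsto_approxOn hfm _ (by simp)
  have hs : ∀ n x, |s n x| ≤ 2 * |f.1 x| := fun n x => by
    have := SimpleFunc.norm_approxOn_zero_le hfm (Set.mem_univ 0) x n
    simp only [Real.norm_eq_abs] at this
    exact this.trans_eq (two_mul _).symm
  have hw : ∀ x, 2 * |f.1 x| ≤ 2 * C * (1 + (x : ℝ) ^ p) := fun x => by linarith [hfC x]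
  have habs : ∀ n, Represents Q ℓ fun x => |s n x| := fun n =>
    represents_simpleFunc hℓ hP hcont ((s n).map fun y => |y|)
  -- This dominates every approximating |s n|, so its value under `ℓ` bounds their L¹ norms and
  -- Fatou makes f(S_N) integrable.
  let u : optionSpace p := ⟨fun x => 2 * |f.1 x|, (hfm.norm).const_mul 2, 2 * C, by positivity,
    fun x => by rw [abs_of_nonneg (by positivity)]; exact hw x⟩
  have hint : Integrable (fun ω => f.1 (terminal ω)) Q := by
    refine integrable_of_tendsto_of_integral_abs_le (C := terminalFunctional ℓ u.1)
      (fun n => (represents_simpleFunc hℓ hP hcont (s n)).1) (fun n => ?_)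
      fun ω => hlim (terminal ω)
    rw [← (habs n).2]
    let v : optionSpace p := ⟨fun x => |s n x|, (s n).measurable.norm, 2 * C, by positivity,
      fun x => by rw [abs_abs]; exact (hs n x).trans (hw x)⟩
    exact hℓ.map_le_of_le hP hκ (option_mem_hedgeable hP hκ v) (option_mem_hedgeable hP hκ u)
      fun ω => hs n _
  exact Represents.of_tendsto hℓ hP (fun n => (s n).measurable)
    (fun n x => (hs n x).trans (hw x)) hlim (fun n => represents_simpleFunc hℓ hP hcont (s n))
    (hint.abs.const_mul 2) hs

end StaticPositions

/-! ### Strong duality for bounded continuous claims -/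

section Duality

open scoped BoundedContinuousFunction

variable {N : ℕ} {κ p : ℝ} {P : optionSpace p → ℝ}

lemma gain_single (i : Fin N) (ψ : PathSpace N → ℝ) (ω : PathSpace N) :
    gain κ (fun j ω => if j = i then ψ ω else 0) ω
      = ψ ω * (price (Fin.last N) ω - price i.castSucc ω) - κ * (price i.castSucc ω * |ψ ω|) := by
  unfold gain
  rw [Finset.sum_eq_single i]
  · simp
  · intro j _ hj
    simp [hj]
  · simp

lemma isProgressive_single (i : Fin N) (φ : (Set.Iic i.castSucc → ℝ) → ℝ) :
    IsProgressive (N := N) fun j ω => if j = i then φ (pastPrices i.castSucc ω) else 0 := by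
  intro j ω ω' h
  by_cases hj : j = i
  · subst hj
    have : pastPrices j.castSucc ω = pastPrices j.castSucc ω' :=
      funext fun l => by simp only [pastPrices, price, h l.1 l.2]
    simp [this]
  · simp [hj]

lemma abs_price_le (k : Fin (N + 1)) (ω : PathSpace N) : |price k ω| ≤ √(sqGrowth ω) :=
  Real.abs_le_sqrt (sq_price_le_sqGrowth k ω)

lemma one_le_sqrt_sqGrowth (ω : PathSpace N) : 1 ≤ √(sqGrowth ω) :=
  Real.one_le_sqrt.2 (one_le_sqGrowth ω)

/-- Strong duality, with a maximizer, for bounded continuous claims. -/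
theorem exists_integral_eq_sInf_hedgePrices (hP : IsPricing p P) (hp : 2 ≤ p) (hκ0 : 0 ≤ κ)
    (hκ : κ ≤ 1 / 4) (h0 : ∀ c ∈ hedgePrices κ P (0 : PathSpace N → ℝ), 0 ≤ c)
    {G : PathSpace N → ℝ} (hG : Continuous G) {C : ℝ} (hC : ∀ ω, |G ω| ≤ C) :
    ∃ Q ∈ consistentLaws N κ P, ∫ ω, G ω ∂Q = sInf (hedgePrices κ P G) := by
  have hbdd : ∀ {F : PathSpace N → ℝ} {B : ℝ}, (∀ ω, |F ω| ≤ B) →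
      ∀ ω, |F ω| ≤ |B| * √(sqGrowth ω) := fun {F B} hF ω =>
    ((hF ω).trans (le_abs_self B)).trans
      (le_mul_of_one_le_right (abs_nonneg B) (one_le_sqrt_sqGrowth ω))
  have hGmem : G ∈ hedgeable N hP hκ0 := mem_hedgeable_of_abs_le hP hp hκ0 hκ fun ω =>
    ((hC ω).trans (le_abs_self C)).trans
      (le_mul_of_one_le_right (abs_nonneg C) (one_le_sqGrowth ω))
  obtain ⟨ℓ, hℓ, hℓG⟩ := exists_pricesBelowCost hP hκ0 h0 hGmem
  obtain ⟨Q, hQfin, hQ⟩ := hℓ.exists_measure hP hp hκ0 hκ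
  have hrep := fun {F : PathSpace N → ℝ} (hF : Continuous F) {B : ℝ}
    (hB : ∀ ω, |F ω| ≤ B * √(sqGrowth ω)) =>
      hℓ.integrable_and_integral_eq hP hp hκ0 hκ hQ hF hB
  have hone := hrep (F := fun _ => 1) continuous_const (B := |1|) (hbdd (by simp))
  have hfinite : IsFiniteMeasure Q := (integrable_const_iff_isFiniteMeasure one_ne_zero).1 hone.1
  have hprob : IsProbabilityMeasure Q := by
    have h1 := hone.2
    rw [hℓ.map_one hP, integral_const, smul_eq_mul, mul_one] at h1
    exact ⟨by rwa [measureReal_def, ENNReal.toReal_eq_one_iff] at h1⟩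
  have hprice : ∀ k : Fin (N + 1), Integrable (price k) Q := fun k =>
    (hrep (continuous_price k) (B := 1) fun ω => by rw [one_mul]; exact abs_price_le k ω).1
  have hstatic : ∀ f : optionSpace p, Represents Q ℓ f.1 :=
    represents_option hℓ hP hκ0 fun φ hφ hφ1 => by
      have h1 := hrep (hφ.comp continuous_terminal) (B := |1|) (hbdd fun ω => hφ1 _)
      exact ⟨h1.1, h1.2.symm⟩
  -- The gain of a single trade has hedging cost at most 0, so `ℓ` is nonpositive on it. Bounded φ
  -- and linear growth of Z allow this to be read as an integral.
  have htrade : ∀ (i : Fin N) (φ : (Set.Iic i.castSucc → ℝ) → ℝ) (Z : PathSpace N → ℝ) (B : ℝ),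
      Continuous φ → (∀ y, |φ y| ≤ B) → Continuous Z → (∀ ω, |Z ω| ≤ 3 * √(sqGrowth ω)) →
      (∀ ω, φ (pastPrices i.castSucc ω) * Z ω
        = -gain κ (fun j ω => if j = i then φ (pastPrices i.castSucc ω) else 0) ω) →
      0 ≤ ∫ ω, φ (pastPrices i.castSucc ω) * Z ω ∂Q := by
    intro i φ Z B hφ hB hZ hZb hgain
    have hB0 : 0 ≤ B := (abs_nonneg _).trans (hB 0)
    have hb : ∀ ω, |φ (pastPrices i.castSucc ω) * Z ω| ≤ B * 3 * √(sqGrowth ω) := fun ω => by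
      rw [abs_mul, mul_assoc]
      exact mul_le_mul (hB _) (hZb ω) (abs_nonneg _) hB0
    rw [(hrep (F := fun ω => φ (pastPrices i.castSucc ω) * Z ω)
      ((hφ.comp (continuous_pastPrices _)).mul hZ) hb).2]
    have hmem : (fun ω => φ (pastPrices i.castSucc ω) * Z ω) ∈ hedgeable N hP hκ0 :=
      mem_hedgeable_of_abs_le hP hp hκ0 hκ (C := B * 3) fun ω => (hb ω).trans <|
        mul_le_mul_of_nonneg_left (Real.sqrt_le_iff.2
          ⟨zero_le_one.trans (one_le_sqGrowth ω), by nlinarith [one_le_sqGrowth ω]⟩)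
          (by positivity)
    have h1 := hℓ _ ((hedgeable N hP hκ0).neg_mem hmem).2 0 (by
      have h2 : (-fun ω => φ (pastPrices i.castSucc ω) * Z ω)
          = gain κ (fun j ω => if j = i then φ (pastPrices i.castSucc ω) else 0) := by
        funext ω
        rw [Pi.neg_apply, hgain, neg_neg]
      rw [h2]
      exact zero_mem_hedgePrices_gain hP (isProgressive_single i φ))
    rw [map_neg] at h1
    linarith
  have hZb : ∀ (i : Fin N) (a b : ℝ), |a| ≤ 1 → |b| ≤ 2 → ∀ ω,
      |a * price (Fin.last N) ω + b * price i.castSucc ω| ≤ 3 * √(sqGrowth ω) := by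
    intro i a b ha hb ω
    have h1 := abs_add_le (a * price (Fin.last N) ω) (b * price i.castSucc ω)
    rw [abs_mul, abs_mul] at h1
    have h2 := mul_le_mul ha (abs_price_le (Fin.last N) ω) (abs_nonneg _) zero_le_one
    have h3 := mul_le_mul hb (abs_price_le i.castSucc ω) (abs_nonneg _) zero_le_two
    linarith
  have hcond : ∀ (i : Fin N) (a b : ℝ),
      (∀ φ : (Set.Iic i.castSucc → ℝ) →ᵇ ℝ≥0, 0 ≤ ∫ ω, (φ (pastPrices i.castSucc ω) : ℝ)
        * (a * price (Fin.last N) ω + b * price i.castSucc ω) ∂Q) →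
      ∀ᵐ ω ∂Q, 0 ≤ a * (Q[price (Fin.last N) | canonicalFiltration N i.castSucc]) ω
        + b * price i.castSucc ω := by
    intro i a b h
    have hint := ((hprice (Fin.last N)).const_mul a).add ((hprice i.castSucc).const_mul b)
    have h1 := condExp_nonneg_of_forall_continuous
      (continuous_pastPrices i.castSucc).measurable hint h
    rw [← canonicalFiltration_eq_comap] at h1
    have hmeas : StronglyMeasurable[canonicalFiltration N i.castSucc]
        (fun ω : PathSpace N => b * price i.castSucc ω) := by
      rw [canonicalFiltration_eq_comap]
      exact (((measurable_pi_apply (⟨i.castSucc, Set.self_mem_Iic⟩ : Set.Iic i.castSucc)).comp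
        (comap_measurable (pastPrices i.castSucc))).const_mul b).stronglyMeasurable
    have hle := (canonicalFiltration N).le i.castSucc
    have h2 := condExp_of_stronglyMeasurable hle hmeas ((hprice i.castSucc).const_mul b)
    filter_upwards [h1, condExp_add ((hprice (Fin.last N)).const_mul a)
      ((hprice i.castSucc).const_mul b) (canonicalFiltration N i.castSucc),
      condExp_smul a (price (Fin.last N)) (canonicalFiltration N i.castSucc) (μ := Q)]
      with ω h3 h4 h5
    have h6 : (Q[fun ω => a * price (Fin.last N) ω | canonicalFiltration N i.castSucc]) ω
        = a * (Q[price (Fin.last N) | canonicalFiltration N i.castSucc]) ω := h5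
    rw [← h6]
    have h7 : (Q[fun ω => b * price i.castSucc ω | canonicalFiltration N i.castSucc]) ω
        = b * price i.castSucc ω := congrFun h2 ω
    rw [← h7]
    exact h3.trans_eq h4
  have hφ : ∀ {i : Fin N} (φ : (Set.Iic i.castSucc → ℝ) →ᵇ ℝ≥0) (y), |(φ y : ℝ)| ≤ dist φ 0 :=
    fun φ y => by simpa [NNReal.dist_eq] using φ.dist_coe_le_dist (g := 0) y
  have hZc : ∀ (i : Fin N) (a b : ℝ),
      Continuous fun ω : PathSpace N => a * price (Fin.last N) ω + b * price i.castSucc ω :=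
    fun i a b => ((continuous_price _).const_mul a).add ((continuous_price _).const_mul b)
  refine ⟨Q, ⟨⟨hprob, hprice _, fun k hk => ?_⟩, fun f => ⟨(hstatic f).1, ?_⟩⟩, ?_⟩
  · obtain ⟨i, rfl⟩ := Fin.exists_castSucc_eq.2 hk.ne
    have ha : |(-1 : ℝ)| ≤ 1 := by norm_num
    have hb : |1 + κ| ≤ 2 := by rw [abs_le]; constructor <;> linarith
    have hb' : |κ - 1| ≤ 2 := by rw [abs_le]; constructor <;> linarith
    -- Buying φ ≥ 0 shares gains φ (S_N - (1 + κ) S_i).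
    have hupper := hcond i (-1) (1 + κ) fun φ => by
      refine htrade i (fun y => φ y) _ (dist φ 0) (NNReal.continuous_coe.comp φ.continuous)
        (fun y => ?_) (hZc i _ _) (hZb i _ _ ha hb) fun ω => ?_
      · exact hφ φ y
      · rw [gain_single, abs_of_nonneg (NNReal.coe_nonneg _)]
        ring
    -- Selling φ ≥ 0 shares gains -φ (S_N - (1 - κ) S_i).
    have hlower := hcond i 1 (κ - 1) fun φ => by
      have h1 := htrade i (fun y => -φ y) (fun ω => -(1 * price (Fin.last N) ω
        + (κ - 1) * price i.castSucc ω)) (dist φ 0) (NNReal.continuous_coe.comp φ.continuous).neg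
        (fun y => ?_) (hZc i _ _).neg (fun ω => ?_) fun ω => ?_
      · simpa only [neg_mul_neg] using h1
      · rw [abs_neg]
        exact hφ φ y
      · rw [abs_neg]
        exact hZb i _ _ (by norm_num) hb' ω
      · rw [gain_single, abs_neg, abs_of_nonneg (NNReal.coe_nonneg _)]
        ring
    filter_upwards [hupper, hlower] with ω h1 h2
    constructor <;> linarith
  · rw [← (hstatic f).2]
    exact hℓ.terminalFunctional_le f
  · rw [← hℓG]
    exact (hrep hG (hbdd hC)).2

end Duality

/-! ### Arbitrage and consistent laws -/

section FundamentalTheorem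

variable {N : ℕ} {κ p : ℝ} {P : optionSpace p → ℝ}

lemma Admissible.hedgePrices_nonempty (hP : IsPricing p P) (hp : 2 ≤ p) (hκ : κ ≤ 1 / 4)
    {G : PathSpace N → ℝ} (hG : Admissible G) : (hedgePrices κ P G).Nonempty := by
  obtain ⟨-, L, hL, h⟩ := hG
  exact hedgePrices_nonempty_of_le hP hp hκ hL fun ω => ((le_abs_self _).trans (h ω)).trans
    (mul_le_mul_of_nonneg_left (pathNorm_sq_le_sqGrowth ω) hL.le)

/-- A claim with finite price excludes arbitrage. -/
lemma hedgePrices_zero_nonneg_of_bot_lt (hP : IsPricing p P) (hκ : 0 ≤ κ) {G : PathSpace N → ℝ}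
    (hG : (hedgePrices κ P G).Nonempty) (h : ⊥ < superCost κ P G) :
    ∀ c ∈ hedgePrices κ P (0 : PathSpace N → ℝ), 0 ≤ c := by
  obtain ⟨x, -, hx⟩ := EReal.lt_iff_exists_real_btwn.1 h
  intro c hc
  by_contra hneg
  obtain ⟨d, hd, hdx⟩ := exists_mem_hedgePrices_lt hP hκ hc (not_le.1 hneg) hG x
  exact absurd (le_superCost_iff.1 hx.le d hd) (not_le.2 hdx)

theorem noModelIndependentArbitrage_iff_nonempty (hP : IsPricing p P) (hp : 2 ≤ p) (hκ0 : 0 ≤ κ)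
    (hκ : κ ≤ 1 / 4) :
    NoModelIndependentArbitrage N κ P ↔ (consistentLaws N κ P).Nonempty := by
  rw [noModelIndependentArbitrage_iff]
  constructor
  · intro h0
    obtain ⟨Q, hQ, -⟩ := exists_integral_eq_sInf_hedgePrices hP hp hκ0 hκ h0
      (G := fun _ => 0) continuous_const (C := 0) (by simp)
    exact ⟨Q, hQ⟩
  · rintro ⟨Q, hQ⟩ c hc
    simpa using integral_le_of_mem_hedgePrices hQ (integrable_zero _ _ _) hc

theorem noModelIndependentArbitrage_iff_exists_bot_lt (hP : IsPricing p P) (hp : 2 ≤ p)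
    (hκ0 : 0 ≤ κ) (hκ : κ ≤ 1 / 4) :
    NoModelIndependentArbitrage N κ P ↔
      ∃ G : PathSpace N → ℝ, Admissible G ∧ ⊥ < superCost κ P G := by
  constructor
  · intro h
    have hadm : Admissible (0 : PathSpace N → ℝ) :=
      ⟨upperSemicontinuous_const, 1, one_pos, fun ω => by
        simp only [Pi.zero_apply, abs_zero]; positivity⟩
    exact ⟨0, hadm, EReal.bot_lt_zero.trans_le (h 0 hadm fun _ => le_rfl)⟩
  · rintro ⟨G, hG, h⟩
    exact noModelIndependentArbitrage_iff.2
      (hedgePrices_zero_nonneg_of_bot_lt hP hκ0 (hG.hedgePrices_nonempty hP hp hκ) h)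

theorem noLocalArbitrage_iff (hP : IsPricing p P) (hp : 2 ≤ p) (hκ0 : 0 ≤ κ) (hκ : κ ≤ 1 / 4) :
    NoLocalArbitrage N κ P ↔ ∀ O : Set (PathSpace N), IsOpen O → O.Nonempty →
      ∃ Q ∈ consistentLaws N κ P, 0 < Q O := by
  constructor
  · rintro h O hO ⟨ω₀, hω₀⟩
    -- A Urysohn bump vanishing off O has positive cost, so the law attaining that cost must charge
    -- O.
    obtain ⟨φ, hφ0, hφ1, hφ⟩ := exists_continuous_zero_one_of_isClosed hO.isClosed_compl
      (isClosed_singleton (x := ω₀)) (Set.disjoint_singleton_right.2 (not_not.2 hω₀))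
    have habs : ∀ ω, |φ ω| ≤ 1 := fun ω => by
      rw [abs_of_nonneg (hφ ω).1]
      exact (hφ ω).2
    have hpos : 0 < superCost κ P φ := h φ φ.continuous ⟨1, habs⟩ (fun ω => (hφ ω).1)
      ⟨ω₀, by rw [hφ1 rfl]; exact one_ne_zero⟩
    have hne : (hedgePrices κ P φ).Nonempty :=
      ⟨1, hedgePrices_anti (fun ω => (hφ ω).2) (const_mem_hedgePrices hP 1)⟩
    obtain ⟨Q, hQ, hint⟩ := exists_integral_eq_sInf_hedgePrices hP hp hκ0 hκ
      (hedgePrices_zero_nonneg_of_bot_lt hP hκ0 hne (EReal.bot_lt_zero.trans hpos))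
      φ.continuous habs
    refine ⟨Q, hQ, pos_iff_ne_zero.2 fun hzero => ?_⟩
    obtain ⟨x, hx0, hx⟩ := EReal.lt_iff_exists_real_btwn.1 hpos
    have hx1 : x ≤ sInf (hedgePrices κ P φ) := le_csInf hne (le_superCost_iff.1 hx.le)
    have hx2 : (0 : ℝ) < x := by exact_mod_cast hx0
    have hvanish : ∫ ω, φ ω ∂Q = 0 := by
      refine integral_eq_zero_of_ae ?_
      filter_upwards [compl_mem_ae_iff.2 hzero] with ω hω
      exact hφ0 hω
    linarith
  · rintro h G hG ⟨C, hC⟩ hG0 ⟨ω₀, hω₀⟩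
    have hopen : IsOpen {ω | 0 < G ω} := isOpen_lt continuous_const hG
    obtain ⟨Q, hQ, hpos⟩ := h _ hopen ⟨ω₀, (hG0 ω₀).lt_of_ne' hω₀⟩
    have := hQ.1.1
    have hint : Integrable G Q :=
      (integrable_const C).mono' hG.aestronglyMeasurable (ae_of_all _ hC)
    have hIpos : 0 < ∫ ω, G ω ∂Q := by
      rw [integral_pos_iff_support_of_nonneg hG0 hint]
      exact hpos.trans_le (measure_mono fun ω hω => ne_of_gt hω)
    exact (EReal.coe_pos.2 hIpos).trans_le
      (le_superCost_iff.2 fun c hc => integral_le_of_mem_hedgePrices hQ hint hc)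

end FundamentalTheorem

end RobustHedging

theorem corollary2p1 (N : ℕ) (κ : ℝ) (hκ0 : 0 < κ) (hκ1 : κ < 1 / 4) (p : ℝ) (hp : 2 < p)
    (P : RobustHedging.optionSpace p → ℝ) (hP : RobustHedging.IsPricing p P) :
    ((RobustHedging.NoModelIndependentArbitrage N κ P ↔
        (RobustHedging.consistentLaws N κ P).Nonempty) ∧
      (RobustHedging.NoModelIndependentArbitrage N κ P ↔
        ∃ G : RobustHedging.PathSpace N → ℝ,
          RobustHedging.Admissible G ∧ ⊥ < RobustHedging.superCost κ P G)) ∧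
    (RobustHedging.NoLocalArbitrage N κ P ↔
      ∀ O : Set (RobustHedging.PathSpace N), IsOpen O → O.Nonempty →
        ∃ Q ∈ RobustHedging.consistentLaws N κ P, 0 < Q O) := by
  exact ⟨⟨RobustHedging.noModelIndependentArbitrage_iff_nonempty hP hp.le hκ0.le hκ1.le,
    RobustHedging.noModelIndependentArbitrage_iff_exists_bot_lt hP hp.le hκ0.le hκ1.le⟩,
    RobustHedging.noLocalArbitrage_iff hP hp.le hκ0.le hκ1.le⟩
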